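/- **Proposition 2.1.** Let $(M,g)$ be a smooth Riemannian manifold of dimension $m$ with Levi-Civita connection $\nabla$, and let $\tau:T(M)\to M$ be its tangent bundle. For $u\in T(M)$, $p=\tau(u)$ and $X\in T_pM$, let $X^V,X^H\in T_uT(M)$ be the vertical and the horizontal lift of $X$: in the coordinates $(x^i,y^i)$ of $T(M)$ induced by a chart of $M$, with Christoffel symbols $\Gamma_{ij}^k$ of $\nabla$, $$X^V=X^i\frac{\partial}{\partial y^i},\qquad X^H=X^i\Big(\frac{\partial}{\partial x^i}-\Gamma_{ij}^k\,y^j\frac{\partial}{\partial y^k}\Big).$$ Put $t=\tfrac12 g_p(u,u)$ and $\mathfrak r=\sqrt{1+2t}$. The Cheeger–Gromoll metric $g_{CG}$ on $T(M)$ is given at $u$ by $$g_{CG}(X^H,Y^H)=g_p(X,Y),\quad g_{CG}(X^H,Y^V)=0,\quad g_{CG}(X^V,Y^V)=\frac{1}{1+2t}\big(g_p(X,Y)+g_p(X,u)g_p(Y,u)\big),$$ and the compatible almost complex structure $J_{CG}$ by $$J_{CG}X^H=\mathfrak r X^V-\frac{1}{1+\mathfrak r}g_p(X,u)\,u^V,\qquad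 J_{CG}X^V=-\frac1{\mathfrak r}X^H-\frac{1}{\mathfrak r(1+\mathfrak r)}g_p(X,u)\,u^H .$$ Let $\Omega_{CG}(U,V)=g_{CG}(U,J_{CG}V)$ be the Kähler form, and let $\omega$ be the $1$-form on $T(M)$ defined at $u$ by $$\omega(X^H)=0,\qquad \omega(X^V)=-\Big(\frac1{\mathfrak r^2}+\frac1{1+\mathfrak r}\Big)g_p(X,u)\qquad (X\in T_pM).$$ Then $\Omega_{CG}$ and $\omega$ are smooth and $$d\Omega_{CG}=\omega\wedge\Omega_{CG}.$$ Moreover, if $m\ge 2$ and $M\neq\emptyset$, then $d\Omega_{CG}\neq 0$; that is, $(T(M),J_{CG},g_{CG})$ is never almost Kähler. -/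

import Mathlib

open Set Filter Topology Bundle Manifold
open scoped Manifold ContDiff Matrix

noncomputable section

/-! ### Differential forms on manifolds -/

section Forms

variable {E : Type*} [NormedAddCommGroup E] [NormedSpace ℝ E]
  {H : Type*} [TopologicalSpace H] (I : ModelWithCorners ℝ E H)
  (N : Type*) [TopologicalSpace N] [ChartedSpace H N]

/-- A (not necessarily smooth) real differential `k`-form on a manifold `N`. -/
abbrev DiffForm (k : ℕ) : Type _ := ∀ x : N, TangentSpace I x [⋀^Fin k]→L[ℝ] ℝ

variable {I N}

/-- The coordinate expression of a `k`-form in the preferred chart at `x₀`, i.e. the pullback of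
the form by the inverse of that chart: a `k`-form on (a part of) the model vector space. -/
def DiffForm.inChart {k : ℕ} (η : DiffForm I N k) (x₀ : N) (y : E) : E [⋀^Fin k]→L[ℝ] ℝ :=
  (η ((extChartAt I x₀).symm y)).compContinuousLinearMap
    (mfderivWithin 𝓘(ℝ, E) I (extChartAt I x₀).symm (range I) y)

/-- A `k`-form is smooth if all its coordinate expressions are smooth. -/
def DiffForm.IsSmooth {k : ℕ} (η : DiffForm I N k) : Prop :=
  ∀ x₀ : N, ContDiffOn ℝ ∞ (η.inChart x₀) (extChartAt I x₀).target

/-- The exterior derivative of a `k`-form on a manifold: its value at `x` is the exterior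
derivative of the coordinate expression of the form in the preferred chart at `x`, pulled back by
that chart.  (For a smooth form any other chart around `x` would give the same value.) -/
def DiffForm.extDer {k : ℕ} (η : DiffForm I N k) : DiffForm I N (k + 1) := fun x =>
  (extDerivWithin (η.inChart x) (range I) (extChartAt I x x)).compContinuousLinearMap
    (mfderiv I 𝓘(ℝ, E) (extChartAt I x) x)

/-- A family of linear functionals on the tangent spaces, as a differential `1`-form. -/
def DiffForm.ofCovector (α : ∀ x : N, TangentSpace I x →L[ℝ] ℝ) : DiffForm I N 1 := fun x =>
  ContinuousAlternatingMap.ofSubsingleton ℝ (TangentSpace I x) ℝ (0 : Fin 1) (α x)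

/-- The wedge product of a covector and an alternating `k`-form on a normed space:
`(α ∧ β)(v₀, …, v_k) = ∑ i, (-1) ^ i * α(v_i) * β(v₀, …, v̂_i, …, v_k)`. -/
def wedgeCovector {k : ℕ} (α : E →L[ℝ] ℝ) (β : E [⋀^Fin k]→L[ℝ] ℝ) :
    E [⋀^Fin (k + 1)]→L[ℝ] ℝ :=
  .alternatizeUncurryFin (α.smulRight β)

theorem wedgeCovector_two_apply (α : E →L[ℝ] ℝ) (β : E [⋀^Fin 2]→L[ℝ] ℝ) (v : Fin 3 → E) :
    wedgeCovector α β v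
      = α (v 0) * β ![v 1, v 2] - α (v 1) * β ![v 0, v 2] + α (v 2) * β ![v 0, v 1] := by
  have h0 : Fin.removeNth 0 v = ![v 1, v 2] := by
    ext i; fin_cases i <;> rfl
  have h1 : Fin.removeNth 1 v = ![v 0, v 2] := by
    ext i; fin_cases i <;> rfl
  have h2 : Fin.removeNth 2 v = ![v 0, v 1] := by
    ext i; fin_cases i <;> rfl
  rw [wedgeCovector, ContinuousAlternatingMap.alternatizeUncurryFin_apply, Fin.sum_univ_three,
    h0, h1, h2]
  simp
  ring

/-- The wedge product of a `1`-form and a `k`-form on a manifold. -/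
def DiffForm.wedge {k : ℕ} (α : ∀ x : N, TangentSpace I x →L[ℝ] ℝ) (β : DiffForm I N k) :
    DiffForm I N (k + 1) := fun x =>
  wedgeCovector (E := E) (α x) (β x)

end Forms

/-! ### The Levi-Civita connection of a Riemannian metric and the tangent bundle -/

section Riemannian

variable {m : ℕ} {M : Type*} [TopologicalSpace M] [ChartedSpace (EuclideanSpace ℝ (Fin m)) M]
  [IsManifold (𝓡 m) ∞ M]

variable (m M) in
/-- A smooth Riemannian metric on the manifold `M` of dimension `m`. -/
abbrev SmoothMetric : Type _ :=
  ContMDiffRiemannianMetric (𝓡 m) ∞ (EuclideanSpace ℝ (Fin m))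
    (fun x : M => TangentSpace (𝓡 m) x)

variable (g : SmoothMetric m M)

/-- The metric coefficients `g_ij = g(∂_i, ∂_j)` in the preferred chart at `c`, as a function of
the coordinates `y`. -/
def metricCoeff (c : M) (y : EuclideanSpace ℝ (Fin m)) : Matrix (Fin m) (Fin m) ℝ :=
  Matrix.of fun i j =>
    g.inner ((extChartAt (𝓡 m) c).symm y)
      (mfderiv 𝓘(ℝ, EuclideanSpace ℝ (Fin m)) (𝓡 m) (extChartAt (𝓡 m) c).symm y
        (EuclideanSpace.single i 1 : EuclideanSpace ℝ (Fin m)))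
      (mfderiv 𝓘(ℝ, EuclideanSpace ℝ (Fin m)) (𝓡 m) (extChartAt (𝓡 m) c).symm y
        (EuclideanSpace.single j 1 : EuclideanSpace ℝ (Fin m)))

/-- The partial derivatives `∂_k g_ij` of the metric coefficients. -/
def metricCoeffDeriv (c : M) (y : EuclideanSpace ℝ (Fin m)) (k i j : Fin m) : ℝ :=
  fderiv ℝ (fun z => metricCoeff g c z i j) y (EuclideanSpace.single k 1)

/-- The Christoffel symbols of the Levi-Civita connection in the preferred chart at `c`:
`Γ^k_ij = 1/2 ∑ l, g^{kl} (∂_i g_jl + ∂_j g_il - ∂_l g_ij)`. -/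
def christoffel (c : M) (y : EuclideanSpace ℝ (Fin m)) (k i j : Fin m) : ℝ :=
  1 / 2 * ∑ l, (metricCoeff g c y)⁻¹ k l *
    (metricCoeffDeriv g c y i j l + metricCoeffDeriv g c y j i l - metricCoeffDeriv g c y l i j)

/-- For `v ∈ T_p M` the linear map `a ↦ ∑ Γ^k_ij(p) a^i v^j ∂_k` on `T_p M`, in the preferred
chart at `p`. (Mathlib identifies `T_p M` with the model space by means of that chart.) -/
def christoffelMap (p : M) (v : EuclideanSpace ℝ (Fin m)) :
    EuclideanSpace ℝ (Fin m) →L[ℝ] EuclideanSpace ℝ (Fin m) :=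
  LinearMap.toContinuousLinearMap
    { toFun := fun a => WithLp.toLp 2 fun k => ∑ i, ∑ j,
        christoffel g p (extChartAt (𝓡 m) p p) k i j * a i * v j
      map_add' := fun a b => by
        ext k
        simp [mul_add, add_mul, Finset.sum_add_distrib]
      map_smul' := fun r a => by
        ext k
        simp only [PiLp.smul_apply, smul_eq_mul, RingHom.id_apply, Finset.mul_sum]
        refine Finset.sum_congr rfl fun i _ => Finset.sum_congr rfl fun j _ => ?_
        ring }

/-- The total space `T(M)` is a manifold with the coordinates `(x^i, y^i)` induced by the charts
of `M`. Mathlib identifies its tangent space at `u` with pairs `(a, b)`, standing for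
`∑ a^i ∂/∂x^i + ∑ b^i ∂/∂y^i` in the coordinates induced by the preferred chart at `τ(u)`. -/
abbrev TTM (u : TangentBundle (𝓡 m) M) : Type := TangentSpace (𝓡 m).tangent u

/-- The differential `τ_*` at `u` of the projection `τ : T(M) → M`; it is `(a, b) ↦ a` in the
induced coordinates, see `projDeriv_eq_mfderiv`. -/
def projDeriv (u : TangentBundle (𝓡 m) M) : TTM u →L[ℝ] TangentSpace (𝓡 m) u.proj :=
  ContinuousLinearMap.fst ℝ (EuclideanSpace ℝ (Fin m)) (EuclideanSpace ℝ (Fin m))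

/-- The connection map at `u`, `(a, b) ↦ b + Γ(a, u)` in the induced coordinates. -/
def connMap (u : TangentBundle (𝓡 m) M) : TTM u →L[ℝ] TangentSpace (𝓡 m) u.proj :=
  (ContinuousLinearMap.snd ℝ (EuclideanSpace ℝ (Fin m)) (EuclideanSpace ℝ (Fin m)) +
    (christoffelMap g u.proj u.snd).comp
      (ContinuousLinearMap.fst ℝ (EuclideanSpace ℝ (Fin m)) (EuclideanSpace ℝ (Fin m))) :
    EuclideanSpace ℝ (Fin m) × EuclideanSpace ℝ (Fin m) →L[ℝ] EuclideanSpace ℝ (Fin m))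

/-- The horizontal lift `X^H` at `u`: `∑ X^i δ_i` with
`δ_i = ∂/∂x^i - ∑ Γ^k_ij y^j ∂/∂y^k`. -/
def hLift (u : TangentBundle (𝓡 m) M) : TangentSpace (𝓡 m) u.proj →L[ℝ] TTM u :=
  ((ContinuousLinearMap.id ℝ (EuclideanSpace ℝ (Fin m))).prod
    (-(christoffelMap g u.proj u.snd)) :
    EuclideanSpace ℝ (Fin m) →L[ℝ] EuclideanSpace ℝ (Fin m) × EuclideanSpace ℝ (Fin m))

/-- The vertical lift `X^V` at `u`: `∑ X^i ∂/∂y^i`, i.e. the velocity at `s = 0` of the curve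
`s ↦ u + s X` in the fiber, see `hasMFDerivAt_fiber_curve`. -/
def vLift (u : TangentBundle (𝓡 m) M) : TangentSpace (𝓡 m) u.proj →L[ℝ] TTM u :=
  ContinuousLinearMap.inr ℝ (EuclideanSpace ℝ (Fin m)) (EuclideanSpace ℝ (Fin m))

theorem projDeriv_vLift (u : TangentBundle (𝓡 m) M) (X : TangentSpace (𝓡 m) u.proj) :
    projDeriv u (vLift u X) = 0 := rfl

theorem projDeriv_hLift (u : TangentBundle (𝓡 m) M) (X : TangentSpace (𝓡 m) u.proj) :
    projDeriv u (hLift g u X) = X := rfl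

theorem connMap_vLift (u : TangentBundle (𝓡 m) M) (X : TangentSpace (𝓡 m) u.proj) :
    connMap g u (vLift u X) = X := by
  have h : ∀ x : EuclideanSpace ℝ (Fin m), x + christoffelMap g u.proj u.snd 0 = x := by simp
  exact h X

theorem connMap_hLift (u : TangentBundle (𝓡 m) M) (X : TangentSpace (𝓡 m) u.proj) :
    connMap g u (hLift g u X) = 0 := by
  change -(christoffelMap g u.proj u.snd (X : EuclideanSpace ℝ (Fin m))) +
    christoffelMap g u.proj u.snd X = 0
  simp

/-- The decomposition of `T_u T(M)` into the horizontal and the vertical space. -/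
theorem hLift_add_vLift (u : TangentBundle (𝓡 m) M) (ξ : TTM u) :
    hLift g u (projDeriv u ξ) + vLift u (connMap g u ξ) = ξ := by
  refine Prod.ext (add_zero ξ.1) ?_
  change -(christoffelMap g u.proj u.snd ξ.1) + (ξ.2 + christoffelMap g u.proj u.snd ξ.1) = ξ.2
  abel

theorem projDeriv_eq_mfderiv (u : TangentBundle (𝓡 m) M) :
    projDeriv u = mfderiv (𝓡 m).tangent (𝓡 m)
      (TotalSpace.proj : TangentBundle (𝓡 m) M → M) u := by
  have h : HasMFDerivAt (𝓡 m).tangent (𝓡 m)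
      (TotalSpace.proj : TangentBundle (𝓡 m) M → M) u (projDeriv u) := by
    refine ⟨(FiberBundle.continuous_proj (EuclideanSpace ℝ (Fin m)) _).continuousAt, ?_⟩
    refine HasFDerivWithinAt.congr_of_eventuallyEq (f := Prod.fst) ?_ ?_ ?_
    · exact hasFDerivWithinAt_fst
    · have ht : (extChartAt (𝓡 m).tangent u).target ∈
          𝓝[range (𝓡 m).tangent] (extChartAt (𝓡 m).tangent u u) :=
        extChartAt_target_mem_nhdsWithin u
      filter_upwards [ht] with z hz
      have hz' : z.1 ∈ (extChartAt (𝓡 m) u.proj).target := by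
        rw [extChartAt_target] at hz
        have h1 := (TangentBundle.mem_chart_target_iff (I := 𝓡 m) _ u).1 hz.1
        rw [extChartAt_target]
        exact ⟨h1, mem_range_self _⟩
      exact (extChartAt (𝓡 m) u.proj).right_inv hz'
    · exact (extChartAt (𝓡 m) u.proj).right_inv ((extChartAt (𝓡 m) u.proj).map_source
        (mem_extChartAt_source u.proj))
  exact h.mfderiv.symm

theorem hasMFDerivAt_fiber_curve (u : TangentBundle (𝓡 m) M) (X : TangentSpace (𝓡 m) u.proj) :
    HasMFDerivAt 𝓘(ℝ, ℝ) (𝓡 m).tangent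
      (fun s : ℝ => (⟨u.proj, u.snd + s • X⟩ : TangentBundle (𝓡 m) M)) 0
      ((ContinuousLinearMap.toSpanSingleton ℝ (vLift u X) :)) := by
  have hx : ∀ w : EuclideanSpace ℝ (Fin m),
      extChartAt (𝓡 m).tangent u (⟨u.proj, w⟩ : TangentBundle (𝓡 m) M)
        = (extChartAt (𝓡 m) u.proj u.proj, w) := by
    intro w
    refine Prod.ext rfl ?_
    exact tangentCoordChange_self (I := 𝓡 m) (mem_extChartAt_source u.proj)
  refine ⟨?_, ?_⟩
  · refine Continuous.continuousAt ?_
    have h1 : Continuous (fun w : TangentSpace (𝓡 m) u.proj =>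
        (⟨u.proj, w⟩ : TangentBundle (𝓡 m) M)) :=
      FiberBundle.continuous_totalSpaceMk (EuclideanSpace ℝ (Fin m)) _ u.proj
    exact h1.comp (continuous_const.add (continuous_id.smul continuous_const))
  · have h2 : ∀ v x : EuclideanSpace ℝ (Fin m), HasFDerivAt
        (fun s : ℝ => (extChartAt (𝓡 m) u.proj u.proj, v + s • x))
        (ContinuousLinearMap.toSpanSingleton ℝ
          ((0, x) : EuclideanSpace ℝ (Fin m) × EuclideanSpace ℝ (Fin m))) 0 := by
      intro v x
      have h3 : HasDerivAt (fun s : ℝ => v + s • x) x 0 := by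
        simpa using ((hasDerivAt_id (0 : ℝ)).smul_const x).const_add v
      exact ((hasDerivAt_const (0 : ℝ) (extChartAt (𝓡 m) u.proj u.proj)).prodMk h3).hasFDerivAt
    have h4 := (h2 u.snd X).hasFDerivWithinAt (s := range 𝓘(ℝ, ℝ))
    refine h4.congr_of_eventuallyEq (Eventually.of_forall fun s => ?_) ?_
    · exact hx (u.snd + s • X)
    · exact hx (u.snd + (0 : ℝ) • X)

/-! ### The Cheeger-Gromoll metric and its almost complex structure -/

/-- The energy density `t = 1/2 g(u, u)`. -/
def energy (u : TangentBundle (𝓡 m) M) : ℝ := 1 / 2 * g.inner u.proj u.snd u.snd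

/-- The function `𝔯 = √(1 + 2t)` on `T(M)`. -/
def rad (u : TangentBundle (𝓡 m) M) : ℝ := √(1 + 2 * energy g u)

/-- The Cheeger-Gromoll metric on `T(M)`. -/
def cgMetric (u : TangentBundle (𝓡 m) M) (ξ η : TTM u) : ℝ :=
  g.inner u.proj (projDeriv u ξ) (projDeriv u η) +
    1 / (1 + 2 * energy g u) *
      (g.inner u.proj (connMap g u ξ) (connMap g u η) +
        g.inner u.proj (connMap g u ξ) u.snd * g.inner u.proj (connMap g u η) u.snd)

/-- The almost complex structure `J_CG` on `T(M)`, see `cgJ_hLift` and `cgJ_vLift`. -/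
def cgJ (u : TangentBundle (𝓡 m) M) : TTM u →L[ℝ] TTM u :=
  (vLift u).comp
      (rad g u • projDeriv u -
        (1 / (1 + rad g u)) • ((g.inner u.proj u.snd).comp (projDeriv u)).smulRight u.snd) +
    (hLift g u).comp
      (-(1 / rad g u) • connMap g u -
        (1 / (rad g u * (1 + rad g u))) •
          ((g.inner u.proj u.snd).comp (connMap g u)).smulRight u.snd)

theorem energy_nonneg (u : TangentBundle (𝓡 m) M) : 0 ≤ energy g u := by
  have h : 0 ≤ g.inner u.proj u.snd u.snd := by
    by_cases hu : u.snd = 0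
    · simp [hu]
    · exact (g.pos u.proj u.snd hu).le
  unfold energy
  positivity

theorem rad_pos (u : TangentBundle (𝓡 m) M) : 0 < rad g u :=
  Real.sqrt_pos.2 (by linarith [energy_nonneg g u])

theorem rad_sq (u : TangentBundle (𝓡 m) M) : rad g u ^ 2 = 1 + 2 * energy g u :=
  Real.sq_sqrt (by linarith [energy_nonneg g u])

theorem inner_self_eq (u : TangentBundle (𝓡 m) M) :
    g.inner u.proj u.snd u.snd = rad g u ^ 2 - 1 := by
  rw [rad_sq, energy]; ring

theorem projDeriv_cgJ (u : TangentBundle (𝓡 m) M) (ξ : TTM u) :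
    projDeriv u (cgJ g u ξ) = -(1 / rad g u) • connMap g u ξ -
      (1 / (rad g u * (1 + rad g u)) * g.inner u.proj (connMap g u ξ) u.snd) • u.snd := by
  simp [cgJ, projDeriv_vLift, projDeriv_hLift, mul_smul, g.symm u.proj u.snd]

theorem connMap_cgJ (u : TangentBundle (𝓡 m) M) (ξ : TTM u) :
    connMap g u (cgJ g u ξ) = rad g u • projDeriv u ξ -
      (1 / (1 + rad g u) * g.inner u.proj (projDeriv u ξ) u.snd) • u.snd := by
  simp [cgJ, connMap_vLift, connMap_hLift, mul_smul, g.symm u.proj u.snd]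

/-- `J_CG X^H = 𝔯 X^V - 1/(1+𝔯) g(X,u) u^V`. -/
theorem cgJ_hLift (u : TangentBundle (𝓡 m) M) (X : TangentSpace (𝓡 m) u.proj) :
    cgJ g u (hLift g u X) = rad g u • vLift u X -
      (1 / (1 + rad g u) * g.inner u.proj X u.snd) • vLift u u.snd := by
  simp [cgJ, projDeriv_hLift, connMap_hLift, mul_smul, g.symm u.proj u.snd]

/-- `J_CG X^V = -1/𝔯 X^H - 1/(𝔯(1+𝔯)) g(X,u) u^H`. -/
theorem cgJ_vLift (u : TangentBundle (𝓡 m) M) (X : TangentSpace (𝓡 m) u.proj) :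
    cgJ g u (vLift u X) = -(1 / rad g u) • hLift g u X -
      (1 / (rad g u * (1 + rad g u)) * g.inner u.proj X u.snd) • hLift g u u.snd := by
  simp [cgJ, projDeriv_vLift, connMap_vLift, mul_smul, g.symm u.proj u.snd]

theorem cgMetric_hLift_hLift (u : TangentBundle (𝓡 m) M) (X Y : TangentSpace (𝓡 m) u.proj) :
    cgMetric g u (hLift g u X) (hLift g u Y) = g.inner u.proj X Y := by
  simp [cgMetric, projDeriv_hLift, connMap_hLift]

theorem cgMetric_hLift_vLift (u : TangentBundle (𝓡 m) M) (X Y : TangentSpace (𝓡 m) u.proj) :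
    cgMetric g u (hLift g u X) (vLift u Y) = 0 := by
  simp [cgMetric, projDeriv_vLift, connMap_hLift]

theorem cgMetric_vLift_vLift (u : TangentBundle (𝓡 m) M) (X Y : TangentSpace (𝓡 m) u.proj) :
    cgMetric g u (vLift u X) (vLift u Y) = 1 / (1 + 2 * energy g u) *
      (g.inner u.proj X Y + g.inner u.proj X u.snd * g.inner u.proj Y u.snd) := by
  simp [cgMetric, projDeriv_vLift, connMap_vLift]

/-- `Ω_CG(ξ, η)` in terms of the horizontal and vertical parts of `ξ` and `η`. -/
theorem cgMetric_cgJ (u : TangentBundle (𝓡 m) M) (ξ η : TTM u) :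
    cgMetric g u ξ (cgJ g u η) = 1 / rad g u *
      ((g.inner u.proj (connMap g u ξ) (projDeriv u η) +
          1 / (1 + rad g u) * g.inner u.proj (connMap g u ξ) u.snd *
            g.inner u.proj (projDeriv u η) u.snd) -
        (g.inner u.proj (projDeriv u ξ) (connMap g u η) +
          1 / (1 + rad g u) * g.inner u.proj (projDeriv u ξ) u.snd *
            g.inner u.proj (connMap g u η) u.snd)) := by
  have hr := rad_pos g u
  have h1 : 1 + rad g u ≠ 0 := by positivity
  rw [cgMetric, projDeriv_cgJ, connMap_cgJ, ← rad_sq]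
  simp only [map_sub, map_smul, sub_apply, smul_apply,
    smul_eq_mul, inner_self_eq]
  field_simp
  ring

/-- `J_CG` is an almost complex structure. -/
theorem cgJ_cgJ (u : TangentBundle (𝓡 m) M) (ξ : TTM u) : cgJ g u (cgJ g u ξ) = -ξ := by
  have hr := rad_pos g u
  have h1 : 1 + rad g u ≠ 0 := by positivity
  have hp : projDeriv u (cgJ g u (cgJ g u ξ)) = projDeriv u (-ξ) := by
    rw [projDeriv_cgJ, connMap_cgJ]
    simp only [map_sub, map_smul, map_neg, sub_apply,
      smul_apply, smul_eq_mul, inner_self_eq]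
    match_scalars <;> field_simp <;> ring
  have hc : connMap g u (cgJ g u (cgJ g u ξ)) = connMap g u (-ξ) := by
    rw [connMap_cgJ, projDeriv_cgJ]
    simp only [map_sub, map_smul, map_neg, sub_apply,
      smul_apply, smul_eq_mul, inner_self_eq]
    match_scalars <;> field_simp <;> ring
  rw [← hLift_add_vLift g u (cgJ g u (cgJ g u ξ)), hp, hc, hLift_add_vLift]

/-- `J_CG` is compatible with the Cheeger-Gromoll metric. -/
theorem cgMetric_cgJ_cgJ (u : TangentBundle (𝓡 m) M) (ξ η : TTM u) :
    cgMetric g u (cgJ g u ξ) (cgJ g u η) = cgMetric g u ξ η := by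
  have hr := rad_pos g u
  have h1 : 1 + rad g u ≠ 0 := by positivity
  rw [cgMetric_cgJ, cgMetric, projDeriv_cgJ, connMap_cgJ, ← rad_sq]
  simp only [map_sub, map_smul, sub_apply,
    smul_apply, smul_eq_mul, inner_self_eq, g.symm u.proj u.snd]
  field_simp
  ring

theorem continuous_metric_inner (p : M) {Z : Type*} [TopologicalSpace Z]
    {a b : Z → TangentSpace (𝓡 m) p} (ha : Continuous a) (hb : Continuous b) :
    Continuous fun z => g.inner p (a z) (b z) := by
  have h : ∀ (B : EuclideanSpace ℝ (Fin m) →L[ℝ] EuclideanSpace ℝ (Fin m) →L[ℝ] ℝ)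
      (a' b' : Z → EuclideanSpace ℝ (Fin m)), Continuous a' → Continuous b' →
      Continuous fun z => B (a' z) (b' z) := by
    intro B a' b' ha' hb'
    fun_prop
  exact h (g.inner p) a b ha hb

/-- The Kähler form `Ω_CG(ξ, η) = g_CG(ξ, J_CG η)`. -/
def cgKahlerForm : DiffForm (𝓡 m).tangent (TangentBundle (𝓡 m) M) 2 := fun u =>
  { toFun := fun v => cgMetric g u (v 0) (cgJ g u (v 1))
    map_update_add' := by
      intro _ v i x y
      simp only [cgMetric_cgJ]
      fin_cases i <;> simp <;> ring
    map_update_smul' := by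
      intro _ v i c x
      simp only [cgMetric_cgJ]
      fin_cases i <;> simp <;> ring
    cont := by
      simp only [cgMetric_cgJ]
      have h0 : Continuous fun v : Fin 2 → TTM u => v 0 := continuous_apply 0
      have h1 : Continuous fun v : Fin 2 → TTM u => v 1 := continuous_apply 1
      have p0 := (projDeriv u).continuous.comp h0
      have p1 := (projDeriv u).continuous.comp h1
      have c0 := (connMap g u).continuous.comp h0
      have c1 := (connMap g u).continuous.comp h1
      have hu : Continuous fun _ : Fin 2 → TTM u => u.snd := continuous_const
      exact continuous_const.mul
        (((continuous_metric_inner g u.proj c0 p1).add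
          ((continuous_const.mul (continuous_metric_inner g u.proj c0 hu)).mul
            (continuous_metric_inner g u.proj p1 hu))).sub
        ((continuous_metric_inner g u.proj p0 c1).add
          ((continuous_const.mul (continuous_metric_inner g u.proj p0 hu)).mul
            (continuous_metric_inner g u.proj c1 hu))))
    map_eq_zero_of_eq' := by
      intro v i j hv hij
      have h : v 0 = v 1 := by
        fin_cases i <;> fin_cases j <;> simp_all
      rw [h, cgMetric_cgJ, g.symm u.proj (connMap g u (v 1)) (projDeriv u (v 1))]
      ring }

/-- The `1`-form `ω` with `ω(X^H) = 0` and `ω(X^V) = -(1/𝔯² + 1/(1+𝔯)) g(X, u)`. -/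
def cgLeeForm (u : TangentBundle (𝓡 m) M) : TTM u →L[ℝ] ℝ :=
  -(1 / rad g u ^ 2 + 1 / (1 + rad g u)) • (g.inner u.proj u.snd).comp (connMap g u)

theorem cgLeeForm_hLift (u : TangentBundle (𝓡 m) M) (X : TangentSpace (𝓡 m) u.proj) :
    cgLeeForm g u (hLift g u X) = 0 := by
  simp [cgLeeForm, connMap_hLift]

theorem cgLeeForm_vLift (u : TangentBundle (𝓡 m) M) (X : TangentSpace (𝓡 m) u.proj) :
    cgLeeForm g u (vLift u X)
      = -(1 / rad g u ^ 2 + 1 / (1 + rad g u)) * g.inner u.proj X u.snd := by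
  simp [cgLeeForm, connMap_vLift, g.symm u.proj u.snd]

end Riemannian

end

/-! Let `θ(ξ) = g(u, τ_* ξ)` be the Liouville form on `T(M)` and `K` the connection map. The
Christoffel formula gives `dt = g(u, Kξ)` (`fderiv_localEnergy_eq`) and `dθ(ξ, η) = g(Kξ, τ_* η) -
g(Kη, τ_* ξ)` (`extDer_liouvilleForm_apply`). Comparing with `cgMetric_cgJ` yields `Ω = r⁻¹ dθ +
(r(1+r))⁻¹ dt ∧ θ` (`cgKahlerForm_apply_eq`), where `r` stands for `𝔯`, while `ω = -(1/r² + 1/(1+r))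
dt`.

From `r² = 1 + 2t` one has `dr = dt/r`, hence `d log(1+r) = dt/(r(1+r))` and `Ω = (1/r - log(1+r))
dθ + d(log(1+r) θ)`. Therefore `dΩ = d(1/r - log(1+r)) ∧ dθ = -(1/r³ + 1/(r(1+r))) dt ∧ dθ`. This
equals `ω ∧ Ω`, because the second term of `Ω` is killed by `dt ∧ dt = 0`. The computation takes
place on a normed space, in `extDeriv_radialForm`. It applies to `T(M)` once `Ω` has the form
`radialForm` throughout each induced chart (`cgKahlerForm_inChart`), which requires `d` to be
compatible with changes of chart (`DiffForm.extDer_inChart`).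

If `m ≥ 2`, take `u = v ≠ 0` and `w ≠ 0` orthogonal to `v`: on `(v^V, w^V, w^H)` the form `ω ∧ Ω`
equals `ω(v^V) g(w, w)/r ≠ 0`. -/

noncomputable section

/-! ### Differential forms in charts and the naturality of `d`. -/

section FormLemmas

variable {E : Type*} [NormedAddCommGroup E] [NormedSpace ℝ E]
  {H : Type*} [TopologicalSpace H] {I : ModelWithCorners ℝ E H} [I.Boundaryless]
  {N : Type*} [TopologicalSpace N] [ChartedSpace H N]

theorem wedgeCovector_compContinuousLinearMap {F : Type*} [NormedAddCommGroup F] [NormedSpace ℝ F]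
    {k : ℕ} (α : E →L[ℝ] ℝ) (β : E [⋀^Fin k]→L[ℝ] ℝ) (A : F →L[ℝ] E) :
    (wedgeCovector α β).compContinuousLinearMap A =
      wedgeCovector (α.comp A) (β.compContinuousLinearMap A) := by
  ext v
  simp only [wedgeCovector, ContinuousAlternatingMap.compContinuousLinearMap_apply,
    ContinuousAlternatingMap.alternatizeUncurryFin_apply]
  rfl

theorem extDeriv_function_smul {k : ℕ} {f : E → ℝ} {η : E → E [⋀^Fin k]→L[ℝ] ℝ} {x : E}
    (hf : DifferentiableAt ℝ f x) (hη : DifferentiableAt ℝ η x) :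
    extDeriv (fun y => f y • η y) x = f x • extDeriv η x + wedgeCovector (fderiv ℝ f x) (η x) := by
  rw [extDeriv, fderiv_fun_smul hf hη, ContinuousAlternatingMap.alternatizeUncurryFin_add,
    ContinuousAlternatingMap.alternatizeUncurryFin_smul]
  rfl

theorem ContDiffOn.extDeriv_of_isOpen {k : ℕ} {η : E → E [⋀^Fin k]→L[ℝ] ℝ} {s : Set E}
    (hη : ContDiffOn ℝ ∞ η s) (hs : IsOpen s) : ContDiffOn ℝ ∞ (extDeriv η) s :=
  (ContinuousAlternatingMap.alternatizeUncurryFinCLM ℝ E ℝ).contDiff.comp_contDiffOn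
    (hη.fderiv_of_isOpen hs le_rfl)

theorem ContDiffOn.wedgeCovector {X : Type*} [NormedAddCommGroup X] [NormedSpace ℝ X] {k : ℕ}
    {α : X → E →L[ℝ] ℝ} {β : X → E [⋀^Fin k]→L[ℝ] ℝ} {s : Set X} (hα : ContDiffOn ℝ ∞ α s)
    (hβ : ContDiffOn ℝ ∞ β s) : ContDiffOn ℝ ∞ (fun y => wedgeCovector (α y) (β y)) s := by
  have h : ContDiff ℝ ∞ (ContinuousAlternatingMap.alternatizeUncurryFinCLM ℝ E ℝ (n := k)) :=
    ContinuousLinearMap.contDiff _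
  exact h.comp_contDiffOn (hα.smulRight hβ)

variable [IsManifold I ∞ N]

/-- The derivative of an inverse chart, in Mathlib's identification of tangent spaces with the
model space, is the derivative of a change of charts. -/
theorem mfderivWithin_extChartAt_symm_eq (x₀ : N) {y : E} (hy : y ∈ (extChartAt I x₀).target) :
    (mfderivWithin 𝓘(ℝ, E) I (extChartAt I x₀).symm (range I) y : E →L[ℝ] E) =
      fderiv ℝ (extChartAt I ((extChartAt I x₀).symm y) ∘ (extChartAt I x₀).symm) y := by
  have : IsManifold I 1 N := .of_le (n := ∞) (by simp)
  rw [(mdifferentiableWithinAt_extChartAt_symm (I := I) hy).mfderivWithin]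
  simp only [writtenInExtChartAt, mfld_simps, I.range_eq_univ, fderivWithin_univ]
  rfl

theorem mfderivWithin_extChartAt_symm_self (x : N) :
    (mfderivWithin 𝓘(ℝ, E) I (extChartAt I x).symm (range I) (extChartAt I x x) : E →L[ℝ] E) =
      ContinuousLinearMap.id ℝ E := by
  rw [mfderivWithin_extChartAt_symm_eq x (mem_extChartAt_target x), extChartAt_to_inv,
    ← fderivWithin_univ, ← I.range_eq_univ]
  exact fderivWithin_extChartAt_comp_extChartAt_symm_range

theorem contDiffAt_extChartAt_comp_symm (x₀ x₁ : N) {y : E} (hy : y ∈ (extChartAt I x₀).target)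
    (hx : (extChartAt I x₀).symm y ∈ (extChartAt I x₁).source) :
    ContDiffAt ℝ ∞ (extChartAt I x₁ ∘ (extChartAt I x₀).symm) y := by
  have h := contDiffWithinAt_ext_coord_change (I := I) (n := ∞) x₁ x₀ (y := y) (by
    rw [PartialEquiv.trans_source]
    exact ⟨hy, hx⟩)
  rwa [I.range_eq_univ, contDiffWithinAt_univ] at h

omit [IsManifold I ∞ N] in
theorem extChartAt_symm_mem_source_eventually (x₀ x₁ : N) {y : E}
    (hy : y ∈ (extChartAt I x₀).target)
    (hx : (extChartAt I x₀).symm y ∈ (extChartAt I x₁).source) :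
    ∀ᶠ z in 𝓝 y, z ∈ (extChartAt I x₀).target ∧
      (extChartAt I x₀).symm z ∈ (extChartAt I x₁).source := by
  refine ((isOpen_extChartAt_target x₀).mem_nhds hy |> Filter.Eventually.and) ?_
  exact (continuousAt_extChartAt_symm'' hy).eventually
    ((isOpen_extChartAt_source x₁).mem_nhds hx)

/-- Chain rule for three charts: `x₀`, `x₁`, and the preferred chart at the point itself, which
serves to identify its tangent space with `E`. -/
theorem fderiv_extChartAt_comp_symm_comp (x₀ x₁ : N) {y : E}
    (hy : y ∈ (extChartAt I x₀).target)
    (hx : (extChartAt I x₀).symm y ∈ (extChartAt I x₁).source) :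
    (mfderivWithin 𝓘(ℝ, E) I (extChartAt I x₀).symm (range I) y : E →L[ℝ] E) =
      (mfderivWithin 𝓘(ℝ, E) I (extChartAt I x₁).symm (range I)
        (extChartAt I x₁ ((extChartAt I x₀).symm y)) : E →L[ℝ] E).comp
      (fderiv ℝ (extChartAt I x₁ ∘ (extChartAt I x₀).symm) y) := by
  have h1 : extChartAt I x₁ ((extChartAt I x₀).symm y) ∈ (extChartAt I x₁).target :=
    (extChartAt I x₁).map_source hx
  have h2 : (extChartAt I x₁).symm (extChartAt I x₁ ((extChartAt I x₀).symm y)) =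
    (extChartAt I x₀).symm y := (extChartAt I x₁).left_inv hx
  rw [mfderivWithin_extChartAt_symm_eq x₀ hy, mfderivWithin_extChartAt_symm_eq x₁ h1, h2]
  have hd1 := (contDiffAt_extChartAt_comp_symm x₀ x₁ hy hx).differentiableAt (by simp)
  have hd2 : DifferentiableAt ℝ
      (extChartAt I ((extChartAt I x₀).symm y) ∘ (extChartAt I x₁).symm)
      ((extChartAt I x₁ ∘ (extChartAt I x₀).symm) y) :=
    (contDiffAt_extChartAt_comp_symm x₁ _ h1
      (by rw [h2]; exact mem_extChartAt_source _)).differentiableAt (by simp)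
  have hc := fderiv_comp y hd2 hd1
  refine Eq.trans (Filter.EventuallyEq.fderiv_eq ?_) hc
  filter_upwards [extChartAt_symm_mem_source_eventually x₀ x₁ hy hx] with z hz
  simp only [Function.comp_apply]
  rw [(extChartAt I x₁).left_inv hz.2]

namespace DiffForm

theorem inChart_self {k : ℕ} (η : DiffForm I N k) (x : N) :
    η.inChart x (extChartAt I x x) = (η x : E [⋀^Fin k]→L[ℝ] ℝ) := by
  have h := mfderivWithin_extChartAt_symm_self (I := I) x
  -- The type of `η p` depends on `p`, so the point and the linear map are made variables before the
  -- equalities are substituted. The same device recurs below.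
  have h2 : ∀ (p : N) (A : E →L[ℝ] E), p = x → A = ContinuousLinearMap.id ℝ E →
      (η p : E [⋀^Fin k]→L[ℝ] ℝ).compContinuousLinearMap A = (η x : E [⋀^Fin k]→L[ℝ] ℝ) := by
    rintro p A rfl rfl
    rfl
  exact h2 _ _ (extChartAt_to_inv x) h

theorem inChart_change {k : ℕ} (η : DiffForm I N k) (x₀ x₁ : N) {y : E}
    (hy : y ∈ (extChartAt I x₀).target)
    (hx : (extChartAt I x₀).symm y ∈ (extChartAt I x₁).source) :
    η.inChart x₀ y = (η.inChart x₁ ((extChartAt I x₁ ∘ (extChartAt I x₀).symm) y)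
      ).compContinuousLinearMap (fderiv ℝ (extChartAt I x₁ ∘ (extChartAt I x₀).symm) y) := by
  have h := fderiv_extChartAt_comp_symm_comp x₀ x₁ hy hx
  have h2 : ∀ (p q : N) (A B C : E →L[ℝ] E), p = q → A = B.comp C →
      (η q : E [⋀^Fin k]→L[ℝ] ℝ).compContinuousLinearMap A =
      ((η p : E [⋀^Fin k]→L[ℝ] ℝ).compContinuousLinearMap B).compContinuousLinearMap C := by
    rintro p q A B C rfl rfl
    rfl
  exact h2 _ _ _ _ _ ((extChartAt I x₁).left_inv hx) h

/-- At the centre of its own chart the differential of the chart is the identity, and without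
boundary the derivative within the range is the full one. -/
theorem extDer_eq {k : ℕ} (η : DiffForm I N k) (x : N) :
    (η.extDer x : E [⋀^Fin (k + 1)]→L[ℝ] ℝ) = extDeriv (η.inChart x) (extChartAt I x x) := by
  have h1 : IsManifold I 1 N := .of_le (n := ∞) (by simp)
  have h2 : ∀ (β : E [⋀^Fin (k + 1)]→L[ℝ] ℝ) (A : E →L[ℝ] E), A = ContinuousLinearMap.id ℝ E →
      β.compContinuousLinearMap A = β := by
    rintro β A rfl
    rfl
  rw [← extDerivWithin_univ, ← I.range_eq_univ]
  exact h2 _ _ mfderiv_extChartAt_self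

/-- Exterior differentiation commutes with passing to any chart. -/
theorem extDer_inChart {k : ℕ} {η : DiffForm I N k} (hη : η.IsSmooth) (x₀ : N) {y : E}
    (hy : y ∈ (extChartAt I x₀).target) :
    η.extDer.inChart x₀ y = extDeriv (η.inChart x₀) y := by
  have hx := mem_extChartAt_source (I := I) ((extChartAt I x₀).symm y)
  set x := (extChartAt I x₀).symm y with hxdef
  have e : η.inChart x₀ =ᶠ[𝓝 y] fun z =>
      (η.inChart x ((extChartAt I x ∘ (extChartAt I x₀).symm) z)).compContinuousLinearMap
        (fderiv ℝ (extChartAt I x ∘ (extChartAt I x₀).symm) z) := by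
    filter_upwards [extChartAt_symm_mem_source_eventually x₀ x hy hx] with z hz
    exact inChart_change η x₀ x hz.1 hz.2
  have hd : DifferentiableAt ℝ (η.inChart x) ((extChartAt I x ∘ (extChartAt I x₀).symm) y) :=
    ((hη x).contDiffAt ((isOpen_extChartAt_target x).mem_nhds
      ((extChartAt I x).map_source hx))).differentiableAt (by simp)
  -- Both sides are pullbacks, along the same change of charts, from the chart centred at `x`; there
  -- `extDer` is the coordinate derivative by definition.
  rw [inChart_change _ x₀ x hy hx, e.extDeriv_eq, extDeriv_pullback hd
    (contDiffAt_extChartAt_comp_symm x₀ x hy hx) (by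
      rw [minSmoothness_of_isRCLikeNormedField]
      exact ENat.LEInfty.out)]
  simp only [Function.comp_apply, ← hxdef]
  rw [inChart_self, extDer_eq]

end DiffForm

end FormLemmas

/-! ### The metric and the induced charts of `T(M)` in coordinates. -/

section LocalMetric

variable {m : ℕ} {M : Type*} [TopologicalSpace M] [ChartedSpace (EuclideanSpace ℝ (Fin m)) M]
  [IsManifold (𝓡 m) ∞ M]

/-- The differential of the inverse of the preferred chart at `c`, in Mathlib's identification of
tangent spaces with the model space. -/
def coordFrame (c : M) (y : EuclideanSpace ℝ (Fin m)) :
    EuclideanSpace ℝ (Fin m) →L[ℝ] EuclideanSpace ℝ (Fin m) :=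
  mfderiv 𝓘(ℝ, EuclideanSpace ℝ (Fin m)) (𝓡 m) (extChartAt (𝓡 m) c).symm y

omit [IsManifold (𝓡 m) ∞ M] in
theorem coordFrame_eq_mfderivWithin (c : M) (y : EuclideanSpace ℝ (Fin m)) :
    coordFrame c y = mfderivWithin 𝓘(ℝ, EuclideanSpace ℝ (Fin m)) (𝓡 m)
      (extChartAt (𝓡 m) c).symm (range (𝓡 m)) y := by
  rw [coordFrame, ← mfderivWithin_univ, (𝓡 m).range_eq_univ]

theorem coordFrame_self (c : M) :
    coordFrame c (extChartAt (𝓡 m) c c) = ContinuousLinearMap.id ℝ _ := by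
  rw [coordFrame_eq_mfderivWithin]
  exact mfderivWithin_extChartAt_symm_self c

theorem extChartAt_tangent_target (u : TangentBundle (𝓡 m) M) :
    (extChartAt (𝓡 m).tangent u).target = (extChartAt (𝓡 m) u.proj).target ×ˢ univ := by
  ext z
  rw [extChartAt_target, extChartAt_target, mem_inter_iff, mem_preimage,
    TangentBundle.mem_chart_target_iff]
  simp

/-- The trivialization of the tangent bundle is the differential of the chart. This lets every
object on `T(M)` be written in an induced chart through `coordFrame`. -/
theorem extChartAt_tangent_symm_apply (u : TangentBundle (𝓡 m) M)
    {y : EuclideanSpace ℝ (Fin m)} (hy : y ∈ (extChartAt (𝓡 m) u.proj).target)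
    (v : EuclideanSpace ℝ (Fin m)) :
    (extChartAt (𝓡 m).tangent u).symm (y, v) =
      ⟨(extChartAt (𝓡 m) u.proj).symm y, coordFrame u.proj y v⟩ := by
  have h1 : IsManifold (𝓡 m) 1 M := .of_le (n := ∞) (by simp)
  have hs : (extChartAt (𝓡 m) u.proj).symm y ∈ (chartAt (EuclideanSpace ℝ (Fin m)) u.proj).source := by
    rw [← extChartAt_source (𝓡 m)]
    exact (extChartAt (𝓡 m) u.proj).map_target hy
  have hb : (extChartAt (𝓡 m) u.proj).symm y ∈ (trivializationAt (EuclideanSpace ℝ (Fin m))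
      (TangentSpace (𝓡 m)) u.proj).baseSet := hs
  have h := DFunLike.congr_fun (TangentBundle.symmL_trivializationAt (I := 𝓡 m) hs) v
  rw [(extChartAt (𝓡 m) u.proj).right_inv hy, Trivialization.symmL_apply _ hb] at h
  rw [coordFrame_eq_mfderivWithin, FiberBundle.extChartAt]
  refine (Trivialization.mk_symm _ hb v).symm.trans ?_
  exact congrArg (TotalSpace.mk _) h

variable (g : SmoothMetric m M)

/-- The metric in the preferred chart at `c`, as a bilinear form on the model space. -/
def localMetric (c : M) (y : EuclideanSpace ℝ (Fin m)) :
    EuclideanSpace ℝ (Fin m) →L[ℝ] EuclideanSpace ℝ (Fin m) →L[ℝ] ℝ :=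
  (g.inner ((extChartAt (𝓡 m) c).symm y) : EuclideanSpace ℝ (Fin m) →L[ℝ]
    EuclideanSpace ℝ (Fin m) →L[ℝ] ℝ).bilinearComp (coordFrame c y) (coordFrame c y)

theorem localMetric_apply (c : M) (y v w : EuclideanSpace ℝ (Fin m)) :
    localMetric g c y v w =
      g.inner ((extChartAt (𝓡 m) c).symm y) (coordFrame c y v) (coordFrame c y w) := rfl

theorem localMetric_symm (c : M) (y v w : EuclideanSpace ℝ (Fin m)) :
    localMetric g c y v w = localMetric g c y w v := g.symm _ _ _

theorem localMetric_self (p : M) (v w : EuclideanSpace ℝ (Fin m)) :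
    localMetric g p (extChartAt (𝓡 m) p p) v w = g.inner p v w := by
  have h : ∀ (q : M) (A : EuclideanSpace ℝ (Fin m) →L[ℝ] EuclideanSpace ℝ (Fin m)), q = p →
      A = ContinuousLinearMap.id ℝ _ → (g.inner q (A v) (A w) : ℝ) = g.inner p v w := by
    rintro q A rfl rfl
    rfl
  exact h _ _ (extChartAt_to_inv p) (coordFrame_self p)

theorem contMDiffOn_coordFrame (c : M) (v : EuclideanSpace ℝ (Fin m)) :
    ContMDiffOn 𝓘(ℝ, EuclideanSpace ℝ (Fin m)) (𝓡 m).tangent ∞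
      (fun y => (⟨(extChartAt (𝓡 m) c).symm y, coordFrame c y v⟩ : TangentBundle (𝓡 m) M))
      (extChartAt (𝓡 m) c).target := by
  -- A coordinate vector field is the inverse induced chart along `y ↦ (y, v)`. The zero vector over
  -- `c` only selects that chart, which depends on the base point alone.
  have h := contMDiffOn_extChartAt_symm (I := (𝓡 m).tangent) (n := ∞)
    (⟨c, 0⟩ : TangentBundle (𝓡 m) M)
  have h2 : ContMDiffOn 𝓘(ℝ, EuclideanSpace ℝ (Fin m))
      𝓘(ℝ, EuclideanSpace ℝ (Fin m) × EuclideanSpace ℝ (Fin m)) ∞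
      (fun y : EuclideanSpace ℝ (Fin m) => (y, v)) (extChartAt (𝓡 m) c).target :=
    (contDiff_id.prodMk contDiff_const).contMDiff.contMDiffOn
  have h3 := h.comp h2 (fun y hy => by
    rw [mem_preimage, extChartAt_tangent_target]
    exact ⟨hy, mem_univ _⟩)
  exact h3.congr fun y hy =>
    (extChartAt_tangent_symm_apply (⟨c, 0⟩ : TangentBundle (𝓡 m) M) hy v).symm

theorem contDiffOn_localMetric (c : M) :
    ContDiffOn ℝ ∞ (localMetric g c) (extChartAt (𝓡 m) c).target := by
  refine contDiffOn_clm_apply.2 fun v => contDiffOn_clm_apply.2 fun w => ?_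
  have hg := g.contMDiff.comp_contMDiffOn (contMDiffOn_extChartAt_symm (I := 𝓡 m) (n := ∞) c)
  have h := ContMDiffOn.clm_bundle_apply₂ (E₃ := fun _ : M => ℝ) (F₃ := ℝ) hg
    (contMDiffOn_coordFrame c v) (contMDiffOn_coordFrame c w)
  intro y hy
  have h' := (contMDiffWithinAt_totalSpace.1 (h y hy)).2
  exact h'.contDiffWithinAt

end LocalMetric

theorem EuclideanSpace.sum_smul_single {ι : Type*} [Fintype ι] [DecidableEq ι]
    (x : EuclideanSpace ℝ ι) : ∑ i, x i • EuclideanSpace.single i (1 : ℝ) = x := by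
  simpa using (EuclideanSpace.basisFun ι ℝ).sum_repr x

/-! ### Christoffel symbols of the first and second kind. -/

section Christoffel

variable {m : ℕ} {M : Type*} [TopologicalSpace M] [ChartedSpace (EuclideanSpace ℝ (Fin m)) M]
  [IsManifold (𝓡 m) ∞ M] (g : SmoothMetric m M)

theorem metricCoeff_apply (c : M) (y : EuclideanSpace ℝ (Fin m)) (i j : Fin m) :
    metricCoeff g c y i j =
      localMetric g c y (EuclideanSpace.single i 1) (EuclideanSpace.single j 1) := rfl

theorem metricCoeff_mulVec (c : M) (y x : EuclideanSpace ℝ (Fin m)) (n : Fin m) :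
    (metricCoeff g c y *ᵥ x) n = localMetric g c y x (EuclideanSpace.single n 1) := by
  rw [localMetric_symm]
  conv_rhs => rw [← EuclideanSpace.sum_smul_single x]
  simp only [map_sum, map_smul, smul_eq_mul, Matrix.mulVec, dotProduct, metricCoeff_apply]
  exact Finset.sum_congr rfl fun k _ => mul_comm _ _

/-- A kernel vector `x` of the Gram matrix would satisfy `g(x, ·) = 0`, contradicting `g(x, x) > 0`.
-/
theorem isUnit_det_metricCoeff (p : M) :
    IsUnit (metricCoeff g p (extChartAt (𝓡 m) p p)).det := by
  rw [isUnit_iff_ne_zero]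
  intro h
  obtain ⟨v, hv, hz⟩ := Matrix.exists_mulVec_eq_zero_iff.2 h
  set x : EuclideanSpace ℝ (Fin m) := WithLp.toLp 2 v with hx
  have hx0 : x ≠ 0 := fun h0 => hv (by
    have := congrArg WithLp.ofLp h0
    simpa [hx] using this)
  have h1 : localMetric g p (extChartAt (𝓡 m) p p) x = 0 := by
    ext w
    rw [← EuclideanSpace.sum_smul_single w, map_sum]
    refine Finset.sum_eq_zero fun i _ => ?_
    rw [map_smul, ← metricCoeff_mulVec, hx, hz, Pi.zero_apply, smul_zero]
  have h2 : (0 : ℝ) < g.inner p x x := g.pos p x hx0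
  rw [← localMetric_self, h1] at h2
  simp at h2

set_option synthInstance.maxHeartbeats 200000 in
/-- The derivatives of the metric in the preferred chart at `p`, at `p`. -/
def localMetricDeriv (p : M) : EuclideanSpace ℝ (Fin m) →L[ℝ] EuclideanSpace ℝ (Fin m) →L[ℝ]
    EuclideanSpace ℝ (Fin m) →L[ℝ] ℝ :=
  fderiv ℝ (localMetric g p) (extChartAt (𝓡 m) p p)

theorem differentiableAt_localMetric (c : M) {y : EuclideanSpace ℝ (Fin m)}
    (hy : y ∈ (extChartAt (𝓡 m) c).target) : DifferentiableAt ℝ (localMetric g c) y :=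
  ((contDiffOn_localMetric g c).contDiffAt
    ((isOpen_extChartAt_target c).mem_nhds hy)).differentiableAt (by simp)

theorem fderiv_localMetric_apply (p : M) (a v w : EuclideanSpace ℝ (Fin m)) :
    fderiv ℝ (fun z => localMetric g p z v w) (extChartAt (𝓡 m) p p) a =
      localMetricDeriv g p a v w := by
  have h := (differentiableAt_localMetric g p (mem_extChartAt_target p)).hasFDerivAt
  have h2 := (h.clm_apply (hasFDerivAt_const v _)).clm_apply (hasFDerivAt_const w _)
  rw [h2.fderiv]
  simp [localMetricDeriv]

theorem localMetricDeriv_symm (p : M) (a v w : EuclideanSpace ℝ (Fin m)) :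
    localMetricDeriv g p a v w = localMetricDeriv g p a w v := by
  simp only [← fderiv_localMetric_apply, localMetric_symm g p _ v w]

theorem metricCoeffDeriv_eq (p : M) (k i j : Fin m) :
    metricCoeffDeriv g p (extChartAt (𝓡 m) p p) k i j =
      localMetricDeriv g p (EuclideanSpace.single k 1) (EuclideanSpace.single i 1)
        (EuclideanSpace.single j 1) :=
  fderiv_localMetric_apply g p _ _ _

set_option synthInstance.maxHeartbeats 200000 in
theorem localMetricDeriv_add (p : M) (a b v w : EuclideanSpace ℝ (Fin m)) :
    localMetricDeriv g p (a + b) v w = localMetricDeriv g p a v w + localMetricDeriv g p b v w := by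
  rw [map_add]
  rfl

set_option synthInstance.maxHeartbeats 200000 in
theorem localMetricDeriv_smul (p : M) (r : ℝ) (a v w : EuclideanSpace ℝ (Fin m)) :
    localMetricDeriv g p (r • a) v w = r * localMetricDeriv g p a v w := by
  rw [map_smul]
  rfl

/-- The Christoffel symbols of the first kind, contracted with three vectors. -/
def christoffelLower (p : M) (a v w : EuclideanSpace ℝ (Fin m)) : ℝ :=
  1 / 2 * (localMetricDeriv g p a v w + localMetricDeriv g p v a w - localMetricDeriv g p w a v)

theorem christoffelLower_eq_sum (p : M) (a v w : EuclideanSpace ℝ (Fin m)) :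
    christoffelLower g p a v w = ∑ i, ∑ j, christoffelLower g p (EuclideanSpace.single i 1)
      (EuclideanSpace.single j 1) w * a i * v j := by
  let B : EuclideanSpace ℝ (Fin m) →ₗ[ℝ] EuclideanSpace ℝ (Fin m) →ₗ[ℝ] ℝ :=
    LinearMap.mk₂ ℝ (fun a v => christoffelLower g p a v w)
      (fun a b v => by
        simp only [christoffelLower, localMetricDeriv_add]
        simp only [map_add, add_apply]
        ring)
      (fun r a v => by
        simp only [christoffelLower, localMetricDeriv_smul]
        simp only [map_smul, smul_apply, smul_eq_mul]
        ring)
      (fun a v b => by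
        simp only [christoffelLower, localMetricDeriv_add]
        simp only [map_add, add_apply]
        ring)
      (fun r a v => by
        simp only [christoffelLower, localMetricDeriv_smul]
        simp only [map_smul, smul_apply, smul_eq_mul]
        ring)
  change B a v = ∑ i, ∑ j, B (EuclideanSpace.single i 1) (EuclideanSpace.single j 1) * a i * v j
  conv_lhs => rw [← EuclideanSpace.sum_smul_single a, ← EuclideanSpace.sum_smul_single v]
  simp only [map_sum, map_smul, LinearMap.sum_apply, LinearMap.smul_apply, smul_eq_mul,
    Finset.mul_sum]
  rw [Finset.sum_comm]
  refine Finset.sum_congr rfl fun i _ => Finset.sum_congr rfl fun j _ => ?_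
  ring

theorem christoffel_eq_sum (p : M) (k i j : Fin m) :
    christoffel g p (extChartAt (𝓡 m) p p) k i j =
      ∑ l, (metricCoeff g p (extChartAt (𝓡 m) p p))⁻¹ k l *
        christoffelLower g p (EuclideanSpace.single i 1) (EuclideanSpace.single j 1)
          (EuclideanSpace.single l 1) := by
  simp only [christoffel, Finset.mul_sum, metricCoeffDeriv_eq, christoffelLower]
  exact Finset.sum_congr rfl fun l _ => by ring

/-- Lowering the index cancels the inverse Gram matrix, so that afterwards only first derivatives of
the metric occur. Both sides are linear in `w`, hence basis vectors suffice. -/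
theorem localMetric_christoffelMap (p : M) (a v w : EuclideanSpace ℝ (Fin m)) :
    localMetric g p (extChartAt (𝓡 m) p p) (christoffelMap g p v a) w =
      christoffelLower g p a v w := by
  set G := metricCoeff g p (extChartAt (𝓡 m) p p) with hG
  set q : Fin m → ℝ := fun l => christoffelLower g p a v (EuclideanSpace.single l 1) with hq
  have h1 : (christoffelMap g p v a).ofLp = G⁻¹ *ᵥ q := by
    ext k
    have hk : (christoffelMap g p v a).ofLp k = ∑ i, ∑ j,
      christoffel g p (extChartAt (𝓡 m) p p) k i j * a i * v j := rfl
    rw [hk, Matrix.mulVec, dotProduct]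
    simp only [hq, christoffelLower_eq_sum g p a v, Finset.mul_sum, christoffel_eq_sum,
      Finset.sum_mul]
    rw [Finset.sum_comm]
    conv_rhs => rw [Finset.sum_comm]; enter [2, j]; rw [Finset.sum_comm]
    rw [Finset.sum_comm]
    refine Finset.sum_congr rfl fun i _ => Finset.sum_congr rfl fun j _ =>
      Finset.sum_congr rfl fun l _ => ?_
    ring
  have h2 : ∀ n, localMetric g p (extChartAt (𝓡 m) p p) (christoffelMap g p v a)
      (EuclideanSpace.single n 1) = christoffelLower g p a v (EuclideanSpace.single n 1) := by
    intro n
    rw [← metricCoeff_mulVec, h1, Matrix.mulVec_mulVec, Matrix.mul_nonsing_inv _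
      (isUnit_det_metricCoeff g p), Matrix.one_mulVec]
  let L : EuclideanSpace ℝ (Fin m) →ₗ[ℝ] ℝ :=
    { toFun := fun w => christoffelLower g p a v w
      map_add' := fun b c => by
        simp only [christoffelLower, localMetricDeriv_add]
        simp only [map_add]
        ring
      map_smul' := fun r b => by
        simp only [christoffelLower, localMetricDeriv_smul]
        simp only [map_smul, smul_eq_mul, RingHom.id_apply]
        ring }
  change _ = L w
  rw [← EuclideanSpace.sum_smul_single w]
  simp only [map_sum, map_smul, h2]
  rfl

end Christoffel

/-! ### The exterior derivative of `r⁻¹ dΘ + (r(1+r))⁻¹ dT ∧ Θ` on a normed space. -/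

section ConformalDerivative

variable {V : Type*} [NormedAddCommGroup V] [NormedSpace ℝ V]

theorem wedgeCovector_one_apply (α : V →L[ℝ] ℝ) (β : V [⋀^Fin 1]→L[ℝ] ℝ) (v : Fin 2 → V) :
    wedgeCovector α β v = α (v 0) * β ![v 1] - α (v 1) * β ![v 0] := by
  have h0 : Fin.removeNth 0 v = ![v 1] := by
    ext i; fin_cases i; rfl
  have h1 : Fin.removeNth 1 v = ![v 0] := by
    ext i; fin_cases i; rfl
  rw [wedgeCovector, ContinuousAlternatingMap.alternatizeUncurryFin_apply, Fin.sum_univ_two,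
    h0, h1]
  simp
  ring

theorem wedgeCovector_wedgeCovector_self (α : V →L[ℝ] ℝ) (β : V [⋀^Fin 1]→L[ℝ] ℝ) :
    wedgeCovector α (wedgeCovector α β) = 0 := by
  ext v
  rw [wedgeCovector_two_apply]
  simp [wedgeCovector_one_apply]
  ring

theorem wedgeCovector_smul_left {k : ℕ} (c : ℝ) (α : V →L[ℝ] ℝ) (β : V [⋀^Fin k]→L[ℝ] ℝ) :
    wedgeCovector (c • α) β = c • wedgeCovector α β := by
  ext v
  simp [wedgeCovector, ContinuousAlternatingMap.alternatizeUncurryFin_apply, Finset.mul_sum]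
  exact Finset.sum_congr rfl fun i _ => by ring

theorem wedgeCovector_add_right {k : ℕ} (α : V →L[ℝ] ℝ) (β γ : V [⋀^Fin k]→L[ℝ] ℝ) :
    wedgeCovector α (β + γ) = wedgeCovector α β + wedgeCovector α γ := by
  ext v
  simp [wedgeCovector, ContinuousAlternatingMap.alternatizeUncurryFin_apply,
    ← Finset.sum_add_distrib]

theorem wedgeCovector_smul_right {k : ℕ} (c : ℝ) (α : V →L[ℝ] ℝ) (β : V [⋀^Fin k]→L[ℝ] ℝ) :
    wedgeCovector α (c • β) = c • wedgeCovector α β := by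
  ext v
  simp [wedgeCovector, ContinuousAlternatingMap.alternatizeUncurryFin_apply, Finset.mul_sum]
  exact Finset.sum_congr rfl fun i _ => by ring

/-- For a function `T` and a `1`-form `Θ` on an open set, the form
`r⁻¹ dΘ + (r (1 + r))⁻¹ dT ∧ Θ`, where `r = √(1 + 2 T)`. -/
def radialForm (T : V → ℝ) (Θ : V → V [⋀^Fin 1]→L[ℝ] ℝ) (z : V) : V [⋀^Fin 2]→L[ℝ] ℝ :=
  (1 / √(1 + 2 * T z)) • extDeriv Θ z +
    (1 / (√(1 + 2 * T z) * (1 + √(1 + 2 * T z)))) • wedgeCovector (fderiv ℝ T z) (Θ z)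

theorem hasFDerivAt_sqrt_one_add {T : V → ℝ} {z : V} (hT : DifferentiableAt ℝ T z)
    (h0 : 0 < 1 + 2 * T z) :
    HasFDerivAt (fun w => √(1 + 2 * T w)) ((1 / √(1 + 2 * T z)) • fderiv ℝ T z) z := by
  have h := ((hT.hasFDerivAt.const_mul 2).const_add 1).sqrt h0.ne'
  refine h.congr_fderiv ?_
  rw [smul_smul]
  congr 1
  field_simp

/-- Since `dr = dT/r`, the second coefficient of `radialForm` is that of an exact form; `log (1 +
r)` is the potential. -/
theorem hasFDerivAt_log_one_add_sqrt {T : V → ℝ} {z : V} (hT : DifferentiableAt ℝ T z)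
    (h0 : 0 < 1 + 2 * T z) :
    HasFDerivAt (fun w => Real.log (1 + √(1 + 2 * T w)))
      ((1 / (√(1 + 2 * T z) * (1 + √(1 + 2 * T z)))) • fderiv ℝ T z) z := by
  have hr : 0 < √(1 + 2 * T z) := Real.sqrt_pos.2 h0
  have h := ((hasFDerivAt_sqrt_one_add hT h0).const_add 1).log (by positivity)
  refine h.congr_fderiv ?_
  rw [smul_smul]
  congr 1
  field_simp

theorem hasFDerivAt_inv_sqrt_one_add {T : V → ℝ} {z : V} (hT : DifferentiableAt ℝ T z)
    (h0 : 0 < 1 + 2 * T z) :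
    HasFDerivAt (fun w => 1 / √(1 + 2 * T w)) (-(1 / √(1 + 2 * T z) ^ 3) • fderiv ℝ T z) z := by
  have hr : 0 < √(1 + 2 * T z) := Real.sqrt_pos.2 h0
  have h := (hasDerivAt_inv hr.ne').comp_hasFDerivAt z (hasFDerivAt_sqrt_one_add hT h0)
  simp only [one_div]
  refine h.congr_fderiv ?_
  rw [smul_smul]
  congr 1
  field_simp

/-- By the Leibniz rule `d(log(1+r) Θ)` produces the `dT ∧ Θ` term plus `log(1+r) dΘ`, which the
first coefficient subtracts again. Equality near `z`, and not just at `z`, is needed in order to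
differentiate. -/
theorem radialForm_eventuallyEq {T : V → ℝ} {Θ : V → V [⋀^Fin 1]→L[ℝ] ℝ} {z : V}
    (hT : ContDiffAt ℝ ∞ T z) (hΘ : ContDiffAt ℝ ∞ Θ z) (h0 : 0 < 1 + 2 * T z) :
    radialForm T Θ =ᶠ[𝓝 z] fun w =>
      (1 / √(1 + 2 * T w) - Real.log (1 + √(1 + 2 * T w))) • extDeriv Θ w +
        extDeriv (fun w => Real.log (1 + √(1 + 2 * T w)) • Θ w) w := by
  have hc : ContinuousAt (fun w => 1 + 2 * T w) z := by
    have := hT.continuousAt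
    fun_prop
  -- Differentiability of a fixed finite order at `z` spreads to a neighbourhood; order `∞` need
  -- not, hence the descent to order 1.
  filter_upwards [hc.eventually (lt_mem_nhds h0), 
    (hT.of_le (m := 1) (by simp)).eventually (by simp),
    (hΘ.of_le (m := 1) (by simp)).eventually (by simp)] with w hw hTw hΘw
  have hH := hasFDerivAt_log_one_add_sqrt (hTw.differentiableAt (by simp)) hw
  rw [extDeriv_function_smul hH.differentiableAt (hΘw.differentiableAt (by simp)), hH.fderiv,
    wedgeCovector_smul_left, radialForm]
  module

/-- After the rewriting of `radialForm_eventuallyEq`, `d² = 0` leaves only `d(1/r - log(1+r)) ∧ dΘ`.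
On the right `dT ∧ dT ∧ Θ` vanishes, and the coefficients agree: `1/r³ + 1/(r(1+r)) = (1/r² +
1/(1+r))/r`. -/
theorem extDeriv_radialForm {T : V → ℝ} {Θ : V → V [⋀^Fin 1]→L[ℝ] ℝ} {z : V}
    (hT : ContDiffAt ℝ ∞ T z) (hΘ : ContDiffAt ℝ ∞ Θ z) (h0 : 0 < 1 + 2 * T z) :
    extDeriv (radialForm T Θ) z =
      wedgeCovector (-(1 / √(1 + 2 * T z) ^ 2 + 1 / (1 + √(1 + 2 * T z))) • fderiv ℝ T z)
        (radialForm T Θ z) := by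
  have hr : 0 < √(1 + 2 * T z) := Real.sqrt_pos.2 h0
  have hTd := hT.differentiableAt (by simp : (∞ : ℕ∞ω) ≠ 0)
  have hH := hasFDerivAt_log_one_add_sqrt hTd h0
  have hf := hasFDerivAt_inv_sqrt_one_add hTd h0
  have h2 : minSmoothness ℝ 2 ≤ ∞ := by
    rw [minSmoothness_of_isRCLikeNormedField]
    exact ENat.LEInfty.out
  have hdΘ : ContDiffAt ℝ ∞ (extDeriv Θ) z :=
    (ContinuousAlternatingMap.alternatizeUncurryFinCLM ℝ V ℝ).contDiff.contDiffAt.comp z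
      (hΘ.fderiv_right le_rfl)
  have hHs : ContDiffAt ℝ ∞ (fun w => Real.log (1 + √(1 + 2 * T w))) z :=
    (contDiffAt_const.add ((contDiffAt_const.add (contDiffAt_const.mul hT)).sqrt h0.ne')).log
      (by positivity)
  have hHΘ : ContDiffAt ℝ ∞ (fun w => Real.log (1 + √(1 + 2 * T w)) • Θ w) z := hHs.smul hΘ
  have hdHΘ : ContDiffAt ℝ ∞ (extDeriv fun w => Real.log (1 + √(1 + 2 * T w)) • Θ w) z :=
    (ContinuousAlternatingMap.alternatizeUncurryFinCLM ℝ V ℝ).contDiff.contDiffAt.comp z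
      (hHΘ.fderiv_right le_rfl)
  have hfH := hf.sub hH
  have hfH' : HasFDerivAt (fun w => 1 / √(1 + 2 * T w) - Real.log (1 + √(1 + 2 * T w))) _ z := hfH
  have hdd := hdΘ.differentiableAt (by simp)
  rw [(radialForm_eventuallyEq hT hΘ h0).extDeriv_eq,
    extDeriv_fun_add (hfH'.differentiableAt.fun_smul hdd) (hdHΘ.differentiableAt (by simp)),
    extDeriv_function_smul hfH'.differentiableAt hdd, hfH'.fderiv,
    extDeriv_extDeriv_apply hΘ h2, extDeriv_extDeriv_apply hHΘ h2, ← sub_smul, radialForm,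
    wedgeCovector_smul_left, wedgeCovector_smul_left, wedgeCovector_add_right,
    wedgeCovector_smul_right, wedgeCovector_smul_right, wedgeCovector_wedgeCovector_self,
    smul_zero, smul_zero, zero_add, add_zero, add_zero, smul_smul]
  congr 1
  field_simp
  ring

theorem ContDiffOn.radialForm {T : V → ℝ} {Θ : V → V [⋀^Fin 1]→L[ℝ] ℝ} {s : Set V}
    (hs : IsOpen s) (hT : ContDiffOn ℝ ∞ T s) (hΘ : ContDiffOn ℝ ∞ Θ s)
    (h0 : ∀ z ∈ s, 0 < 1 + 2 * T z) : ContDiffOn ℝ ∞ (radialForm T Θ) s := by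
  have hr : ContDiffOn ℝ ∞ (fun z => √(1 + 2 * T z)) s :=
    (contDiffOn_const.add (contDiffOn_const.mul hT)).sqrt fun z hz => (h0 z hz).ne'
  have hp : ∀ z ∈ s, 0 < √(1 + 2 * T z) := fun z hz => Real.sqrt_pos.2 (h0 z hz)
  refine ((contDiffOn_const.div hr fun z hz => (hp z hz).ne').smul
    (hΘ.extDeriv_of_isOpen hs)).add ?_
  refine (contDiffOn_const.div (hr.mul (contDiffOn_const.add hr)) fun z hz => ?_).smul
    ((hT.fderiv_of_isOpen hs le_rfl).wedgeCovector hΘ)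
  have := hp z hz
  positivity

end ConformalDerivative

/-! ### The energy density and the Liouville form in induced charts. -/

section TangentForms

theorem ContDiffOn.ofSubsingleton {X V : Type*} [NormedAddCommGroup X] [NormedSpace ℝ X]
    [NormedAddCommGroup V] [NormedSpace ℝ V] {α : X → V →L[ℝ] ℝ} {s : Set X}
    (hα : ContDiffOn ℝ ∞ α s) :
    ContDiffOn ℝ ∞ (fun z => ContinuousAlternatingMap.ofSubsingleton ℝ V ℝ (0 : Fin 1) (α z)) s := by
  have h : ContDiff ℝ ∞ (ContinuousAlternatingMap.ofSubsingletonLIE (𝕜 := ℝ) (E := V) (F := ℝ)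
      (0 : Fin 1)) := LinearIsometryEquiv.contDiff _
  exact h.comp_contDiffOn hα

variable {m : ℕ} {M : Type*} [TopologicalSpace M] [ChartedSpace (EuclideanSpace ℝ (Fin m)) M]
  [IsManifold (𝓡 m) ∞ M] (g : SmoothMetric m M)

/-- The Liouville form `X ↦ g(u, τ_* X)` on `T(M)`. -/
def liouvilleForm (u : TangentBundle (𝓡 m) M) : TTM u →L[ℝ] ℝ :=
  (g.inner u.proj u.snd).comp (projDeriv u)

/-- The differential of the energy density, see `energyDiff_comp_mfderivWithin`. -/
def energyDiff (u : TangentBundle (𝓡 m) M) : TTM u →L[ℝ] ℝ :=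
  (g.inner u.proj u.snd).comp (connMap g u)

/-- The energy density in the coordinates induced by the preferred chart at `c`. -/
def localEnergy (c : M) (z : EuclideanSpace ℝ (Fin m) × EuclideanSpace ℝ (Fin m)) : ℝ :=
  1 / 2 * localMetric g c z.1 z.2 z.2

/-- The Liouville form in the coordinates induced by the preferred chart at `c`. -/
def localLiouville (c : M) (z : EuclideanSpace ℝ (Fin m) × EuclideanSpace ℝ (Fin m)) :
    EuclideanSpace ℝ (Fin m) × EuclideanSpace ℝ (Fin m) →L[ℝ] ℝ :=
  (localMetric g c z.1 z.2).comp (ContinuousLinearMap.fst ℝ _ _)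

theorem energy_extChartAt_symm (u : TangentBundle (𝓡 m) M)
    {z : EuclideanSpace ℝ (Fin m) × EuclideanSpace ℝ (Fin m)}
    (hz : z ∈ (extChartAt (𝓡 m).tangent u).target) :
    energy g ((extChartAt (𝓡 m).tangent u).symm z) = localEnergy g u.proj z := by
  rw [extChartAt_tangent_target] at hz
  have h := extChartAt_tangent_symm_apply u hz.1 z.2
  rw [Prod.mk.eta] at h
  rw [h]
  rfl

/-- In induced coordinates `τ` is the first projection: differentiate `τ ∘ φ⁻¹ = ψ⁻¹ ∘ fst`, with
`ψ` the chart of `M` and `φ` the chart of `T(M)` it induces. -/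
theorem projDeriv_comp_mfderivWithin (u : TangentBundle (𝓡 m) M)
    {z : EuclideanSpace ℝ (Fin m) × EuclideanSpace ℝ (Fin m)}
    (hz : z ∈ (extChartAt (𝓡 m).tangent u).target) :
    ((projDeriv ((extChartAt (𝓡 m).tangent u).symm z)).comp
      (mfderivWithin 𝓘(ℝ, EuclideanSpace ℝ (Fin m) × EuclideanSpace ℝ (Fin m)) (𝓡 m).tangent
        (extChartAt (𝓡 m).tangent u).symm (range (𝓡 m).tangent) z) :
      EuclideanSpace ℝ (Fin m) × EuclideanSpace ℝ (Fin m) →L[ℝ] EuclideanSpace ℝ (Fin m)) =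
      (coordFrame u.proj z.1).comp (ContinuousLinearMap.fst ℝ _ _) := by
  have h1 : IsManifold (𝓡 m) 1 M := .of_le (n := ∞) (by simp)
  have h2 : IsManifold (𝓡 m).tangent 1 (TangentBundle (𝓡 m) M) := .of_le (n := ∞) (by simp)
  have hz' := hz
  rw [extChartAt_tangent_target] at hz'
  have hs : MDifferentiableAt 𝓘(ℝ, EuclideanSpace ℝ (Fin m) × EuclideanSpace ℝ (Fin m))
      (𝓡 m).tangent (extChartAt (𝓡 m).tangent u).symm z := by
    have := mdifferentiableWithinAt_extChartAt_symm (I := (𝓡 m).tangent) hz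
    rwa [ModelWithCorners.range_eq_univ, mdifferentiableWithinAt_univ] at this
  have hs' : MDifferentiableAt 𝓘(ℝ, EuclideanSpace ℝ (Fin m))
      (𝓡 m) (extChartAt (𝓡 m) u.proj).symm z.1 := by
    have := mdifferentiableWithinAt_extChartAt_symm (I := (𝓡 m)) hz'.1
    rwa [ModelWithCorners.range_eq_univ, mdifferentiableWithinAt_univ] at this
  have hp : MDifferentiableAt (𝓡 m).tangent (𝓡 m)
      (TotalSpace.proj : TangentBundle (𝓡 m) M → M) ((extChartAt (𝓡 m).tangent u).symm z) :=
    (contMDiff_proj (TangentSpace (𝓡 m) : M → Type _) (n := 1)).mdifferentiable (by simp) _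
  rw [projDeriv_eq_mfderiv, ModelWithCorners.range_eq_univ, mfderivWithin_univ]
  refine (mfderiv_comp z hp hs).symm.trans ?_
  have hf : MDifferentiableAt 𝓘(ℝ, EuclideanSpace ℝ (Fin m) × EuclideanSpace ℝ (Fin m))
      𝓘(ℝ, EuclideanSpace ℝ (Fin m)) Prod.fst z := differentiableAt_fst.mdifferentiableAt
  have hc := mfderiv_comp z hs' hf
  have he : TotalSpace.proj ∘ (extChartAt (𝓡 m).tangent u).symm =ᶠ[𝓝 z]
      (extChartAt (𝓡 m) u.proj).symm ∘ Prod.fst := by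
    filter_upwards [(isOpen_extChartAt_target u).mem_nhds hz] with w hw
    rw [extChartAt_tangent_target] at hw
    have h := extChartAt_tangent_symm_apply u hw.1 w.2
    rw [Prod.mk.eta] at h
    rw [Function.comp_apply, h]
    rfl
  refine (he.mfderiv_eq).trans (hc.trans ?_)
  rw [mfderiv_eq_fderiv, fderiv_fst]
  rfl

theorem liouvilleForm_inChart (u : TangentBundle (𝓡 m) M)
    {z : EuclideanSpace ℝ (Fin m) × EuclideanSpace ℝ (Fin m)}
    (hz : z ∈ (extChartAt (𝓡 m).tangent u).target) :
    (DiffForm.ofCovector (liouvilleForm g)).inChart u z =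
      ContinuousAlternatingMap.ofSubsingleton ℝ
        (EuclideanSpace ℝ (Fin m) × EuclideanSpace ℝ (Fin m)) ℝ (0 : Fin 1)
        (localLiouville g u.proj z) := by
  have hp := projDeriv_comp_mfderivWithin u hz
  have hz' := hz
  rw [extChartAt_tangent_target] at hz'
  have hx := extChartAt_tangent_symm_apply u hz'.1 z.2
  rw [Prod.mk.eta] at hx
  have key : ∀ (x : TangentBundle (𝓡 m) M)
      (A : EuclideanSpace ℝ (Fin m) × EuclideanSpace ℝ (Fin m) →L[ℝ]
        EuclideanSpace ℝ (Fin m) × EuclideanSpace ℝ (Fin m)),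
      x = ⟨(extChartAt (𝓡 m) u.proj).symm z.1, coordFrame u.proj z.1 z.2⟩ →
      (ContinuousLinearMap.comp (projDeriv x) A : EuclideanSpace ℝ (Fin m) ×
        EuclideanSpace ℝ (Fin m) →L[ℝ] EuclideanSpace ℝ (Fin m)) =
        (coordFrame u.proj z.1).comp (ContinuousLinearMap.fst ℝ _ _) →
      ∀ w, liouvilleForm g x (A w) = localLiouville g u.proj z w := by
    rintro x A rfl hA w
    have hw := DFunLike.congr_fun hA w
    exact congrArg (fun e : EuclideanSpace ℝ (Fin m) =>
      (g.inner ((extChartAt (𝓡 m) u.proj).symm z.1) (coordFrame u.proj z.1 z.2) e : ℝ)) hw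
  ext v
  exact key _ _ hx hp (v 0)

theorem contDiffOn_localMetric_fst (u : TangentBundle (𝓡 m) M) :
    ContDiffOn ℝ ∞ (fun z : EuclideanSpace ℝ (Fin m) × EuclideanSpace ℝ (Fin m) =>
      localMetric g u.proj z.1) (extChartAt (𝓡 m).tangent u).target := by
  refine (contDiffOn_localMetric g u.proj).comp contDiff_fst.contDiffOn fun z hz => ?_
  rw [extChartAt_tangent_target] at hz
  exact hz.1

theorem contDiffOn_localEnergy (u : TangentBundle (𝓡 m) M) :
    ContDiffOn ℝ ∞ (localEnergy g u.proj) (extChartAt (𝓡 m).tangent u).target :=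
  contDiffOn_const.mul (((contDiffOn_localMetric_fst g u).clm_apply contDiff_snd.contDiffOn).clm_apply
    contDiff_snd.contDiffOn)

theorem contDiffOn_localLiouville (u : TangentBundle (𝓡 m) M) :
    ContDiffOn ℝ ∞ (localLiouville g u.proj) (extChartAt (𝓡 m).tangent u).target :=
  ((contDiffOn_localMetric_fst g u).clm_apply contDiff_snd.contDiffOn).clm_comp contDiffOn_const

theorem isSmooth_liouvilleForm : (DiffForm.ofCovector (liouvilleForm g)).IsSmooth := by
  intro u
  refine ContDiffOn.congr ?_ fun z hz => liouvilleForm_inChart g u hz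
  exact (contDiffOn_localLiouville g u).ofSubsingleton

theorem extChartAt_tangent_self (u : TangentBundle (𝓡 m) M) :
    extChartAt (𝓡 m).tangent u u = (extChartAt (𝓡 m) u.proj u.proj, u.snd) :=
  Prod.ext rfl (tangentCoordChange_self (I := 𝓡 m) (mem_extChartAt_source u.proj))

end TangentForms

/-! ### The differentials `dt` and `dθ`, and the Kähler form expressed by them. -/

section KahlerForm

variable {m : ℕ} {M : Type*} [TopologicalSpace M] [ChartedSpace (EuclideanSpace ℝ (Fin m)) M]
  [IsManifold (𝓡 m) ∞ M] (g : SmoothMetric m M)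

-- Product rule: the metric varies with the base point and is linear in the fibre vector. Only the
-- values of the derivative are used, so `L` is left unspecified.
set_option synthInstance.maxHeartbeats 200000 in
theorem hasFDerivAt_localMetric_snd (p : M) (v : EuclideanSpace ℝ (Fin m)) :
    ∃ L : EuclideanSpace ℝ (Fin m) × EuclideanSpace ℝ (Fin m) →L[ℝ]
      EuclideanSpace ℝ (Fin m) →L[ℝ] ℝ,
      HasFDerivAt (fun z : EuclideanSpace ℝ (Fin m) × EuclideanSpace ℝ (Fin m) =>
        localMetric g p z.1 z.2) L (extChartAt (𝓡 m) p p, v) ∧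
      ∀ ξ w, L ξ w = localMetricDeriv g p ξ.1 v w + g.inner p ξ.2 w := by
  have h1 : HasFDerivAt (localMetric g p) (localMetricDeriv g p) (extChartAt (𝓡 m) p p) :=
    (differentiableAt_localMetric g p (mem_extChartAt_target p)).hasFDerivAt
  have hf : HasFDerivAt (Prod.fst : EuclideanSpace ℝ (Fin m) × EuclideanSpace ℝ (Fin m) → _)
      (ContinuousLinearMap.fst ℝ _ _) (extChartAt (𝓡 m) p p, v) := hasFDerivAt_fst
  have h2 : HasFDerivAt (fun z : EuclideanSpace ℝ (Fin m) × EuclideanSpace ℝ (Fin m) =>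
      localMetric g p z.1) ((localMetricDeriv g p).comp (ContinuousLinearMap.fst ℝ _ _))
      (extChartAt (𝓡 m) p p, v) :=
    HasFDerivAt.comp (g := localMetric g p) (extChartAt (𝓡 m) p p, v) h1 hf
  refine ⟨_, h2.clm_apply hasFDerivAt_snd, fun ξ w => ?_⟩
  rw [← localMetric_self, add_comm]
  rfl

theorem fderiv_localMetric_snd_apply (p : M) (v w : EuclideanSpace ℝ (Fin m))
    (ξ : EuclideanSpace ℝ (Fin m) × EuclideanSpace ℝ (Fin m)) :
    fderiv ℝ (fun z : EuclideanSpace ℝ (Fin m) × EuclideanSpace ℝ (Fin m) =>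
      localMetric g p z.1 z.2 w) (extChartAt (𝓡 m) p p, v) ξ =
      localMetricDeriv g p ξ.1 v w + g.inner p ξ.2 w := by
  obtain ⟨L, hL, h⟩ := hasFDerivAt_localMetric_snd g p v
  rw [(hL.clm_apply (hasFDerivAt_const w _)).fderiv, ← h]
  simp

theorem fderiv_localEnergy_apply (p : M) (v : EuclideanSpace ℝ (Fin m))
    (ξ : EuclideanSpace ℝ (Fin m) × EuclideanSpace ℝ (Fin m)) :
    fderiv ℝ (localEnergy g p) (extChartAt (𝓡 m) p p, v) ξ =
      1 / 2 * localMetricDeriv g p ξ.1 v v + g.inner p v ξ.2 := by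
  obtain ⟨L, hL, h⟩ := hasFDerivAt_localMetric_snd g p v
  have h1 := (hL.clm_apply hasFDerivAt_snd).const_mul (1 / 2)
  have h2 : HasFDerivAt (localEnergy g p) _ (extChartAt (𝓡 m) p p, v) := h1
  have hs : (g.inner p ξ.2 v : ℝ) = g.inner p v ξ.2 := g.symm p _ _
  rw [h2.fderiv]
  simp only [smul_apply, add_apply, ContinuousLinearMap.comp_apply, ContinuousLinearMap.flip_apply,
    ContinuousLinearMap.coe_snd', h, localMetric_self, smul_eq_mul, hs]
  ring

/-- The bridge between the geometry and coordinate derivatives: paired with the metric, the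
connection map involves only Christoffel symbols of the first kind. -/
theorem inner_connMap (u : TangentBundle (𝓡 m) M)
    (ξ : EuclideanSpace ℝ (Fin m) × EuclideanSpace ℝ (Fin m)) (w : EuclideanSpace ℝ (Fin m)) :
    g.inner u.proj (connMap g u ξ) w =
      g.inner u.proj ξ.2 w + christoffelLower g u.proj ξ.1 u.snd w := by
  have h : ∀ v : EuclideanSpace ℝ (Fin m), localMetric g u.proj (extChartAt (𝓡 m) u.proj u.proj)
      (ξ.2 + christoffelMap g u.proj v ξ.1) w =
      g.inner u.proj ξ.2 w + christoffelLower g u.proj ξ.1 v w := by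
    intro v
    rw [map_add, add_apply, localMetric_christoffelMap, localMetric_self]
  exact (localMetric_self g u.proj _ w).symm.trans (h u.snd)

/-- `energyDiff` is the differential of the energy density in the preferred induced chart. -/
theorem fderiv_localEnergy_eq (u : TangentBundle (𝓡 m) M) :
    fderiv ℝ (localEnergy g u.proj) (extChartAt (𝓡 m).tangent u u) =
      (energyDiff g u : EuclideanSpace ℝ (Fin m) × EuclideanSpace ℝ (Fin m) →L[ℝ] ℝ) := by
  refine ContinuousLinearMap.ext fun ξ => ?_
  have h : energyDiff g u ξ = g.inner u.proj u.snd (connMap g u ξ) := rfl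
  rw [extChartAt_tangent_self]
  refine (fderiv_localEnergy_apply g u.proj u.snd ξ).trans (Eq.trans ?_ h.symm)
  rw [g.symm u.proj u.snd]
  refine Eq.trans ?_ (inner_connMap g u ξ u.snd).symm
  -- With the last two arguments equal, two of the three terms of `christoffelLower` cancel and half
  -- the derivative of `g(v, v)` along `ξ.1` remains. This is the compatibility of the connection
  -- with the metric.
  have key : ∀ (v : EuclideanSpace ℝ (Fin m)) (x y : ℝ), x = y →
      1 / 2 * localMetricDeriv g u.proj ξ.1 v v + x = y + christoffelLower g u.proj ξ.1 v v := by
    rintro v x _ rfl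
    rw [christoffelLower]
    ring
  exact key u.snd _ _ (g.symm u.proj _ _)

theorem extDeriv_localLiouville_apply (p : M) (v : EuclideanSpace ℝ (Fin m))
    (ξ : Fin 2 → EuclideanSpace ℝ (Fin m) × EuclideanSpace ℝ (Fin m)) :
    extDeriv (fun z => ContinuousAlternatingMap.ofSubsingleton ℝ
        (EuclideanSpace ℝ (Fin m) × EuclideanSpace ℝ (Fin m)) ℝ (0 : Fin 1)
        (localLiouville g p z)) (extChartAt (𝓡 m) p p, v) ξ =
      (localMetricDeriv g p (ξ 0).1 v (ξ 1).1 + g.inner p (ξ 0).2 (ξ 1).1) -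
        (localMetricDeriv g p (ξ 1).1 v (ξ 0).1 + g.inner p (ξ 1).2 (ξ 0).1) := by
  have hd : ContDiffOn ℝ ∞ (fun z => ContinuousAlternatingMap.ofSubsingleton ℝ
        (EuclideanSpace ℝ (Fin m) × EuclideanSpace ℝ (Fin m)) ℝ (0 : Fin 1)
        (localLiouville g p z)) (extChartAt (𝓡 m).tangent (⟨p, v⟩ : TangentBundle (𝓡 m) M)).target :=
    (contDiffOn_localLiouville g (⟨p, v⟩ : TangentBundle (𝓡 m) M)).ofSubsingleton
  have hd' := (hd.contDiffAt ((isOpen_extChartAt_target _).mem_nhds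
    (mem_extChartAt_target _))).differentiableAt (by simp)
  rw [extChartAt_tangent_self] at hd'
  refine (extDeriv_apply hd' ξ).trans ?_
  rw [Fin.sum_univ_two]
  have h0 := fderiv_localMetric_snd_apply g p v (ξ 1).1 (ξ 0)
  have h1 := fderiv_localMetric_snd_apply g p v (ξ 0).1 (ξ 1)
  rw [← h0, ← h1]
  simp
  rfl

/-- In the difference of the two Christoffel terms the derivatives of the metric along `u` cancel by
symmetry, and the other halves combine to the coordinate expression of `dθ`. -/
theorem extDer_liouvilleForm_apply (u : TangentBundle (𝓡 m) M) (ξ : Fin 2 → TTM u) :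
    (DiffForm.ofCovector (liouvilleForm g)).extDer u ξ =
      g.inner u.proj (connMap g u (ξ 0)) (projDeriv u (ξ 1)) -
        g.inner u.proj (connMap g u (ξ 1)) (projDeriv u (ξ 0)) := by
  have h := DFunLike.congr_fun ((DiffForm.ofCovector (liouvilleForm g)).extDer_eq u) ξ
  have e : (DiffForm.ofCovector (liouvilleForm g)).inChart u =ᶠ[𝓝 (extChartAt (𝓡 m).tangent u u)]
      fun z => ContinuousAlternatingMap.ofSubsingleton ℝ
        (EuclideanSpace ℝ (Fin m) × EuclideanSpace ℝ (Fin m)) ℝ (0 : Fin 1)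
        (localLiouville g u.proj z) := by
    filter_upwards [(isOpen_extChartAt_target u).mem_nhds (mem_extChartAt_target u)] with z hz
    exact liouvilleForm_inChart g u hz
  rw [e.extDeriv_eq, extChartAt_tangent_self] at h
  refine h.trans ((extDeriv_localLiouville_apply g u.proj u.snd ξ).trans ?_)
  have h0 := inner_connMap g u (ξ 0) (ξ 1).1
  have h1 := inner_connMap g u (ξ 1) (ξ 0).1
  refine Eq.trans ?_ (congrArg₂ (· - ·) h0 h1).symm
  simp only [christoffelLower, localMetricDeriv_symm g u.proj u.snd (ξ 1).1 (ξ 0).1,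
    localMetricDeriv_symm g u.proj _ (ξ 1).1 u.snd, localMetricDeriv_symm g u.proj _ (ξ 0).1 u.snd]
  ring

/-- The Kähler form in terms of the Liouville form and the energy density. -/
theorem cgKahlerForm_apply_eq (u : TangentBundle (𝓡 m) M) (ξ : Fin 2 → TTM u) :
    cgKahlerForm g u ξ = 1 / rad g u * (DiffForm.ofCovector (liouvilleForm g)).extDer u ξ +
      1 / (rad g u * (1 + rad g u)) *
        DiffForm.wedge (energyDiff g) (DiffForm.ofCovector (liouvilleForm g)) u ξ := by
  have hr := rad_pos g u
  have hw := wedgeCovector_one_apply (V := EuclideanSpace ℝ (Fin m) × EuclideanSpace ℝ (Fin m))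
    (energyDiff g u : EuclideanSpace ℝ (Fin m) × EuclideanSpace ℝ (Fin m) →L[ℝ] ℝ)
    (DiffForm.ofCovector (liouvilleForm g) u :
      (EuclideanSpace ℝ (Fin m) × EuclideanSpace ℝ (Fin m)) [⋀^Fin 1]→L[ℝ] ℝ) ξ
  have h1 : DiffForm.wedge (energyDiff g) (DiffForm.ofCovector (liouvilleForm g)) u ξ =
      g.inner u.proj u.snd (connMap g u (ξ 0)) * g.inner u.proj u.snd (projDeriv u (ξ 1)) -
      g.inner u.proj u.snd (connMap g u (ξ 1)) * g.inner u.proj u.snd (projDeriv u (ξ 0)) := hw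
  have h2 : cgKahlerForm g u ξ = cgMetric g u (ξ 0) (cgJ g u (ξ 1)) := rfl
  rw [h1, h2, cgMetric_cgJ, extDer_liouvilleForm_apply]
  simp only [g.symm u.proj u.snd, g.symm u.proj (projDeriv u (ξ 0)) (connMap g u (ξ 1))]
  field_simp
  ring

/-- The differential of the energy density in an induced chart. -/
theorem energyDiff_comp_mfderivWithin (u : TangentBundle (𝓡 m) M)
    {z : EuclideanSpace ℝ (Fin m) × EuclideanSpace ℝ (Fin m)}
    (hz : z ∈ (extChartAt (𝓡 m).tangent u).target) :
    ((energyDiff g ((extChartAt (𝓡 m).tangent u).symm z)).comp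
      (mfderivWithin 𝓘(ℝ, EuclideanSpace ℝ (Fin m) × EuclideanSpace ℝ (Fin m)) (𝓡 m).tangent
        (extChartAt (𝓡 m).tangent u).symm (range (𝓡 m).tangent) z) :
      EuclideanSpace ℝ (Fin m) × EuclideanSpace ℝ (Fin m) →L[ℝ] ℝ) =
      fderiv ℝ (localEnergy g u.proj) z := by
  have hx := mem_extChartAt_source (I := (𝓡 m).tangent) ((extChartAt (𝓡 m).tangent u).symm z)
  have hm := mfderivWithin_extChartAt_symm_eq (I := (𝓡 m).tangent) u hz
  set x := (extChartAt (𝓡 m).tangent u).symm z with hxdef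
  set ϕ := extChartAt (𝓡 m).tangent x ∘ (extChartAt (𝓡 m).tangent u).symm with hϕ
  have hϕz : ϕ z = extChartAt (𝓡 m).tangent x x := rfl
  have hdϕ : DifferentiableAt ℝ ϕ z :=
    (contDiffAt_extChartAt_comp_symm u x hz hx).differentiableAt (by simp)
  have hdE : DifferentiableAt ℝ (localEnergy g x.proj) (ϕ z) :=
    ((contDiffOn_localEnergy g x).contDiffAt ((isOpen_extChartAt_target x).mem_nhds
      (mem_extChartAt_target x))).differentiableAt (by simp)
  -- Energy is a function on `T(M)`, so its two coordinate expressions differ by the change of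
  -- charts `ϕ`. This reduces the claim to the centre of the chart at `x`, where
  -- `fderiv_localEnergy_eq` applies.
  have e : localEnergy g u.proj =ᶠ[𝓝 z] localEnergy g x.proj ∘ ϕ := by
    filter_upwards [extChartAt_symm_mem_source_eventually u x hz hx] with w hw
    rw [← energy_extChartAt_symm g u hw.1, hϕ, Function.comp_apply, Function.comp_apply,
      ← energy_extChartAt_symm g x ((extChartAt (𝓡 m).tangent x).map_source hw.2),
      (extChartAt (𝓡 m).tangent x).left_inv hw.2]
  rw [e.fderiv_eq, fderiv_comp z hdE hdϕ, hϕz, fderiv_localEnergy_eq]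
  exact congrArg (fun A : EuclideanSpace ℝ (Fin m) × EuclideanSpace ℝ (Fin m) →L[ℝ]
    EuclideanSpace ℝ (Fin m) × EuclideanSpace ℝ (Fin m) =>
    (energyDiff g x : EuclideanSpace ℝ (Fin m) × EuclideanSpace ℝ (Fin m) →L[ℝ] ℝ).comp A) hm

end KahlerForm

/-! ### Smoothness, the formula for `dΩ`, and its nonvanishing. -/

section KahlerDerivative

variable {m : ℕ} {M : Type*} [TopologicalSpace M] [ChartedSpace (EuclideanSpace ℝ (Fin m)) M]
  [IsManifold (𝓡 m) ∞ M] (g : SmoothMetric m M)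

theorem rad_extChartAt_symm (u : TangentBundle (𝓡 m) M)
    {z : EuclideanSpace ℝ (Fin m) × EuclideanSpace ℝ (Fin m)}
    (hz : z ∈ (extChartAt (𝓡 m).tangent u).target) :
    rad g ((extChartAt (𝓡 m).tangent u).symm z) = √(1 + 2 * localEnergy g u.proj z) := by
  rw [rad, energy_extChartAt_symm g u hz]

theorem one_add_two_mul_localEnergy_pos (u : TangentBundle (𝓡 m) M)
    {z : EuclideanSpace ℝ (Fin m) × EuclideanSpace ℝ (Fin m)}
    (hz : z ∈ (extChartAt (𝓡 m).tangent u).target) : 0 < 1 + 2 * localEnergy g u.proj z := by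
  rw [← energy_extChartAt_symm g u hz]
  linarith [energy_nonneg g ((extChartAt (𝓡 m).tangent u).symm z)]

/-- The Kähler form in an induced chart. -/
theorem cgKahlerForm_inChart (u : TangentBundle (𝓡 m) M)
    {z : EuclideanSpace ℝ (Fin m) × EuclideanSpace ℝ (Fin m)}
    (hz : z ∈ (extChartAt (𝓡 m).tangent u).target) :
    (cgKahlerForm g).inChart u z = radialForm (localEnergy g u.proj)
      ((DiffForm.ofCovector (liouvilleForm g)).inChart u) z := by
  refine ContinuousAlternatingMap.ext fun v => ?_
  have h1 := cgKahlerForm_apply_eq g ((extChartAt (𝓡 m).tangent u).symm z) fun i =>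
    mfderivWithin 𝓘(ℝ, EuclideanSpace ℝ (Fin m) × EuclideanSpace ℝ (Fin m)) (𝓡 m).tangent
        (extChartAt (𝓡 m).tangent u).symm (range (𝓡 m).tangent) z (v i)
  have h2 := DFunLike.congr_fun (DiffForm.extDer_inChart (isSmooth_liouvilleForm g) u hz) v
  have h3 := wedgeCovector_compContinuousLinearMap
    (E := EuclideanSpace ℝ (Fin m) × EuclideanSpace ℝ (Fin m))
    (F := EuclideanSpace ℝ (Fin m) × EuclideanSpace ℝ (Fin m))
    (energyDiff g ((extChartAt (𝓡 m).tangent u).symm z))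
    (DiffForm.ofCovector (liouvilleForm g) ((extChartAt (𝓡 m).tangent u).symm z))
    (mfderivWithin 𝓘(ℝ, EuclideanSpace ℝ (Fin m) × EuclideanSpace ℝ (Fin m)) (𝓡 m).tangent
        (extChartAt (𝓡 m).tangent u).symm (range (𝓡 m).tangent) z)
  have h4 := (DFunLike.congr_fun h3 v).trans (congrArg (fun α => wedgeCovector α
    ((DiffForm.ofCovector (liouvilleForm g)).inChart u z) v) (energyDiff_comp_mfderivWithin g u hz))
  refine h1.trans ?_
  rw [rad_extChartAt_symm g u hz]
  -- Termwise pullback of `cgKahlerForm_apply_eq`: `h2` is naturality of `d` for the Liouville form,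
  -- `h4` that of the wedge with `dt`.
  exact congrArg₂ (fun a b => _ * a + _ * b) h2 h4

theorem isSmooth_cgKahlerForm : (cgKahlerForm g).IsSmooth := fun u =>
  ((contDiffOn_localEnergy g u).radialForm (isOpen_extChartAt_target u)
    (isSmooth_liouvilleForm g u) fun _ hz => one_add_two_mul_localEnergy_pos g u hz).congr
    fun _ hz => cgKahlerForm_inChart g u hz

theorem cgLeeForm_inChart (u : TangentBundle (𝓡 m) M)
    {z : EuclideanSpace ℝ (Fin m) × EuclideanSpace ℝ (Fin m)}
    (hz : z ∈ (extChartAt (𝓡 m).tangent u).target) :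
    (DiffForm.ofCovector (cgLeeForm g)).inChart u z =
      ContinuousAlternatingMap.ofSubsingleton ℝ
        (EuclideanSpace ℝ (Fin m) × EuclideanSpace ℝ (Fin m)) ℝ (0 : Fin 1)
        (-(1 / √(1 + 2 * localEnergy g u.proj z) ^ 2 + 1 / (1 + √(1 + 2 * localEnergy g u.proj z))) •
          fderiv ℝ (localEnergy g u.proj) z) := by
  refine ContinuousAlternatingMap.ext fun v => ?_
  rw [← rad_extChartAt_symm g u hz]
  exact congrArg (fun α : EuclideanSpace ℝ (Fin m) × EuclideanSpace ℝ (Fin m) →L[ℝ] ℝ =>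
    -(1 / rad g ((extChartAt (𝓡 m).tangent u).symm z) ^ 2 +
      1 / (1 + rad g ((extChartAt (𝓡 m).tangent u).symm z))) * α (v 0))
    (energyDiff_comp_mfderivWithin g u hz)

theorem isSmooth_cgLeeForm : (DiffForm.ofCovector (cgLeeForm g)).IsSmooth := by
  intro u
  refine ContDiffOn.congr ?_ fun z hz => cgLeeForm_inChart g u hz
  have hT := contDiffOn_localEnergy g u
  have h0 := fun z hz => one_add_two_mul_localEnergy_pos g u (z := z) hz
  have hr : ContDiffOn ℝ ∞ (fun z => √(1 + 2 * localEnergy g u.proj z))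
      (extChartAt (𝓡 m).tangent u).target :=
    (contDiffOn_const.add (contDiffOn_const.mul hT)).sqrt fun z hz => (h0 z hz).ne'
  have hp := fun z hz => Real.sqrt_pos.2 (h0 z hz)
  refine ContDiffOn.ofSubsingleton (ContDiffOn.smul (ContDiffOn.neg (ContDiffOn.add
    (contDiffOn_const.div (hr.pow 2) fun z hz => ?_)
    (contDiffOn_const.div (contDiffOn_const.add hr) fun z hz => ?_)))
    (hT.fderiv_of_isOpen (isOpen_extChartAt_target u) le_rfl))
  · have := hp z hz
    positivity
  · have := hp z hz
    positivity

/-- The identity is pointwise, so at each `u` the chart centred at `u` is enough: there `dT` becomes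
`energyDiff`, and `extDeriv_radialForm` is the claim. -/
theorem extDer_cgKahlerForm :
    (cgKahlerForm g).extDer = DiffForm.wedge (cgLeeForm g) (cgKahlerForm g) := by
  funext u
  have ht := (isOpen_extChartAt_target (I := (𝓡 m).tangent) u).mem_nhds (mem_extChartAt_target u)
  have e : (cgKahlerForm g).inChart u =ᶠ[𝓝 (extChartAt (𝓡 m).tangent u u)]
      radialForm (localEnergy g u.proj) ((DiffForm.ofCovector (liouvilleForm g)).inChart u) := by
    filter_upwards [ht] with z hz
    exact cgKahlerForm_inChart g u hz
  have h := extDeriv_radialForm ((contDiffOn_localEnergy g u).contDiffAt ht)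
    ((isSmooth_liouvilleForm g u).contDiffAt ht)
    (one_add_two_mul_localEnergy_pos g u (mem_extChartAt_target u))
  have hr := rad_extChartAt_symm g u (mem_extChartAt_target u)
  rw [extChartAt_to_inv] at hr
  rw [← e.extDeriv_eq, ← e.self_of_nhds, fderiv_localEnergy_eq, ← hr, DiffForm.inChart_self] at h
  exact ((cgKahlerForm g).extDer_eq u).trans h

theorem exists_ne_zero_inner_eq_zero (hm : 2 ≤ m) (p : M) :
    ∃ v w : TangentSpace (𝓡 m) p, v ≠ 0 ∧ w ≠ 0 ∧ g.inner p v w = 0 := by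
  have hs : ∀ i : Fin m, (EuclideanSpace.single i 1 : EuclideanSpace ℝ (Fin m)) ≠ 0 := by
    intro i h
    simpa using congrArg (fun x : EuclideanSpace ℝ (Fin m) => x i) h
  let i : Fin m := ⟨0, by omega⟩
  let j : Fin m := ⟨1, by omega⟩
  let v : TangentSpace (𝓡 m) p := (EuclideanSpace.single i 1 : EuclideanSpace ℝ (Fin m))
  let w : TangentSpace (𝓡 m) p := (EuclideanSpace.single j 1 : EuclideanSpace ℝ (Fin m))
  have hv : v ≠ 0 := hs i
  have hvv := (g.pos p v hv).ne'
  -- One Gram-Schmidt step; the result is nonzero because its coordinate `j` is still 1.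
  refine ⟨v, w - (g.inner p v w / g.inner p v v) • v, hv, fun h => ?_, ?_⟩
  · have h' : (EuclideanSpace.single j 1 : EuclideanSpace ℝ (Fin m)) -
        (g.inner p v w / g.inner p v v : ℝ) • EuclideanSpace.single i 1 = 0 := h
    have := congrArg (fun x : EuclideanSpace ℝ (Fin m) => x j) h'
    simp [i, j] at this
  · rw [map_sub, map_smul, smul_eq_mul]
    field_simp
    ring

theorem extDer_cgKahlerForm_ne_zero (hm : 2 ≤ m) [hM : Nonempty M] :
    (cgKahlerForm g).extDer ≠ 0 := by
  obtain ⟨p⟩ := hM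
  obtain ⟨v, w, hv, hw, hvw⟩ := exists_ne_zero_inner_eq_zero g hm p
  intro h
  rw [extDer_cgKahlerForm] at h
  let u : TangentBundle (𝓡 m) M := ⟨p, v⟩
  -- On this triple only the first of the three wedge terms survives, as `ω(w^H) = 0` and `ω(w^V)`
  -- is a multiple of `g(w, v) = 0`. The remaining factor is `Ω(w^V, w^H) = g(w, w)/r`.
  have h1 : DiffForm.wedge (cgLeeForm g) (cgKahlerForm g) u
      ![vLift u v, vLift u w, hLift g u w] = 0 := by
    rw [h]
    rfl
  have h2 := (wedgeCovector_two_apply (E := EuclideanSpace ℝ (Fin m) × EuclideanSpace ℝ (Fin m))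
    (cgLeeForm g u) (cgKahlerForm g u) ![vLift u v, vLift u w, hLift g u w]).symm.trans h1
  have h3 : cgLeeForm g u (vLift u v) * cgMetric g u (vLift u w) (cgJ g u (hLift g u w)) -
      cgLeeForm g u (vLift u w) * cgMetric g u (vLift u v) (cgJ g u (hLift g u w)) +
      cgLeeForm g u (hLift g u w) * cgMetric g u (vLift u v) (cgJ g u (vLift u w)) = 0 := h2
  have hwv : g.inner p w v = 0 := by rw [g.symm, hvw]
  have hr := rad_pos g u
  have hvv := g.pos p v hv
  have hww := g.pos p w hw
  simp only [cgLeeForm_hLift, cgLeeForm_vLift, cgMetric_cgJ, connMap_vLift, connMap_hLift,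
    projDeriv_vLift, projDeriv_hLift, map_zero, zero_apply] at h3
  have e1 : g.inner u.proj w u.snd = 0 := hwv
  have e2 : 0 < g.inner u.proj v u.snd := hvv
  have e3 : 0 < g.inner u.proj w w := hww
  rw [e1] at h3
  have h4 : (1 / rad g u ^ 2 + 1 / (1 + rad g u)) * g.inner u.proj v u.snd *
      (1 / rad g u * g.inner u.proj w w) = 0 := by linarith
  have h5 : 0 < (1 / rad g u ^ 2 + 1 / (1 + rad g u)) * g.inner u.proj v u.snd *
      (1 / rad g u * g.inner u.proj w w) := by positivity
  exact h5.ne' h4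

end KahlerDerivative

end

theorem proposition2p1 {m : ℕ} {M : Type*} [TopologicalSpace M]
    [ChartedSpace (EuclideanSpace ℝ (Fin m)) M] [IsManifold (𝓡 m) ∞ M] (g : SmoothMetric m M) :
    (cgKahlerForm g).IsSmooth ∧
    (DiffForm.ofCovector (cgLeeForm g)).IsSmooth ∧
    (∀ (u : TangentBundle (𝓡 m) M) (X : TangentSpace (𝓡 m) u.proj),
      cgLeeForm g u (hLift g u X) = 0 ∧
      cgLeeForm g u (vLift u X)
        = -(1 / rad g u ^ 2 + 1 / (1 + rad g u)) * g.inner u.proj X u.snd) ∧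
    (cgKahlerForm g).extDer = DiffForm.wedge (cgLeeForm g) (cgKahlerForm g) ∧
    (2 ≤ m → Nonempty M → (cgKahlerForm g).extDer ≠ 0) :=
  ⟨isSmooth_cgKahlerForm g, isSmooth_cgLeeForm g,
    fun u X => ⟨cgLeeForm_hLift g u X, cgLeeForm_vLift g u X⟩, extDer_cgKahlerForm g,
    fun hm _ => extDer_cgKahlerForm_ne_zero g hm⟩
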